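/- Identifying two distinct vertices $u,v$ of a finite simple graph replaces them by a new vertex that is adjacent to all other vertices that were adjacent to $u$ or to $v$. An instance of Clique-Identification (respectively Cluster-Identification) is a pair $(G,k)$ of a finite simple graph $G$ on $n$ vertices and an integer $k\ge 0$; it is a yes-instance if at most $k$ successive identifications can transform $G$ into a complete graph (respectively, into a cluster graph, that is, a graph each of whose connected components is a complete graph). Let $p=\max\{n-k,0\}$. Theorem. Clique-Identification and Cluster-Identification, parameterized by $p=n-k$, admit kernels with $O(p^4)$ vertices. That is, for each of the two problems there are a constant $c$ and a polynomial-time algorithm that transforms every instance $(G,k)$ into an instance $(G',k')$ of the same problem such that $(G',k')$ is a yes-instance if and only if $(G,k)$ is one, and both $|V(G')|$ and $k'$ are at most $c\cdot\max\{1,p\}^4$. -/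

import Mathlib

namespace VertexIdentification

/-! ### Vertex identification and the identification problems -/

/-- The identification of two distinct vertices `u` and `v` of `G`. The vertex `u` of the result plays
the role of the new vertex, and `v` disappears: the new vertex is adjacent to all neighbours (other
than `u` and `v`) of `u` and of `v`, and nothing else changes. -/
def identify {V : Type} (G : SimpleGraph V) (u v : V) : SimpleGraph {x : V // x ≠ v} where
  Adj x y := x ≠ y ∧
    (G.Adj x.1 y.1 ∨ (x.1 = u ∧ G.Adj v y.1) ∨ (y.1 = u ∧ G.Adj x.1 v))
  symm := ⟨by
    rintro x y ⟨hne, h | ⟨hx, h⟩ | ⟨hy, h⟩⟩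
    · exact ⟨hne.symm, Or.inl h.symm⟩
    · exact ⟨hne.symm, Or.inr (Or.inr ⟨hx, h.symm⟩)⟩
    · exact ⟨hne.symm, Or.inr (Or.inl ⟨hy, h.symm⟩)⟩⟩
  loopless := ⟨fun _ h => h.1 rfl⟩

/-- A class of graphs. -/
def GraphClass : Type 1 := ∀ V : Type, SimpleGraph V → Prop

/-- Complete graphs: the vertex set is a clique. -/
def completeGraphs : GraphClass := fun _ G => G.IsClique Set.univ

/-- Cluster graphs: every connected component is a complete graph. -/
def clusterGraphs : GraphClass := fun _ G => ∀ C : G.ConnectedComponent, G.IsClique C.supp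

/-- `CanIdentifyInto H k V G`: at most `k` successive identifications transform `G` into a graph of
the class `H`. -/
def CanIdentifyInto (H : GraphClass) : ℕ → ∀ V : Type, SimpleGraph V → Prop
  | 0, V, G => H V G
  | k + 1, V, G => H V G ∨
      ∃ u v : V, u ≠ v ∧ CanIdentifyInto H k {x : V // x ≠ v} (identify G u v)

/-- An instance `(G, k)`: a finite graph `G` with vertex set `{0, …, n - 1}`, and a number `k`. -/
structure Instance where
  n : ℕ
  G : SimpleGraph (Fin n)
  k : ℕ

/-- The problem `H`-Identification, as the set of its yes-instances. -/
def Identification (H : GraphClass) : Set Instance :=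
  {I | CanIdentifyInto H I.k (Fin I.n) I.G}

/-- Clique-Identification. -/
def CliqueIdentification : Set Instance := Identification completeGraphs

/-- Cluster-Identification. -/
def ClusterIdentification : Set Instance := Identification clusterGraphs

/-- The dual parameter `p = n - k`. The subtraction is truncated, that is, `p = 0` if `n < k`. -/
def Instance.dualParam (I : Instance) : ℕ := I.n - I.k

open scoped Classical in
/-- The encoding of `(G, k)` as a list of words: the number `n` of vertices, the number `k`, and the
`n * n` entries of the adjacency matrix of `G`, row by row. -/
noncomputable def Instance.encode (I : Instance) : List ℕ :=
  I.n :: I.k :: List.ofFn (fun e : Fin (I.n * I.n) =>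
    if I.G.Adj (finProdFinEquiv.symm e).1 (finProdFinEquiv.symm e).2 then 1 else 0)

/-! ### Random access machines

Structured programs for a unit-cost random access machine whose only arithmetic is addition and
truncated subtraction. Numbers at most double with every addition, so that their lengths stay
polynomial in running time and input length, and polynomial time on this machine is the same
as polynomial time on a Turing machine. A program mentions finitely many registers and arrays. -/

/-- Memory: registers and arrays, which hold natural numbers. -/
structure Memory where
  reg : ℕ → ℕ
  arr : ℕ → ℕ → ℕ

/-- Expressions; `load a e` reads cell `e` of array `a`. -/
inductive Expr where
  | const (c : ℕ)
  | reg (x : ℕ)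
  | load (a : ℕ) (e : Expr)
  | add (e₁ e₂ : Expr)
  | sub (e₁ e₂ : Expr)

/-- The value of an expression. -/
def Expr.val (s : Memory) : Expr → ℕ
  | .const c => c
  | .reg x => s.reg x
  | .load a e => s.arr a (e.val s)
  | .add e₁ e₂ => e₁.val s + e₂.val s
  | .sub e₁ e₂ => e₁.val s - e₂.val s

/-- The number of elementary operations in the evaluation of an expression. -/
def Expr.cost : Expr → ℕ
  | .const _ => 1
  | .reg _ => 1
  | .load _ e => e.cost + 1
  | .add e₁ e₂ => e₁.cost + e₂.cost + 1
  | .sub e₁ e₂ => e₁.cost + e₂.cost + 1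

/-- Programs. A condition `e` holds if the value of `e` is nonzero. -/
inductive Prog where
  | skip
  | assign (x : ℕ) (e : Expr)
  | store (a : ℕ) (i e : Expr)
  | seq (P Q : Prog)
  | cond (e : Expr) (P Q : Prog)
  | loop (e : Expr) (P : Prog)

/-- `Exec P s s' t`: the program `P`, started in `s`, halts in `s'` after exactly `t` steps. -/
inductive Exec : Prog → Memory → Memory → ℕ → Prop where
  | skip (s : Memory) : Exec .skip s s 1
  | assign (x : ℕ) (e : Expr) (s : Memory) :
      Exec (.assign x e) s ⟨Function.update s.reg x (e.val s), s.arr⟩ (e.cost + 1)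
  | store (a : ℕ) (i e : Expr) (s : Memory) :
      Exec (.store a i e) s
        ⟨s.reg, Function.update s.arr a (Function.update (s.arr a) (i.val s) (e.val s))⟩
        (i.cost + e.cost + 1)
  | seq {P Q : Prog} {s s' s'' : Memory} {t t' : ℕ} :
      Exec P s s' t → Exec Q s' s'' t' → Exec (.seq P Q) s s'' (t + t')
  | condTrue {e : Expr} {P Q : Prog} {s s' : Memory} {t : ℕ} :
      e.val s ≠ 0 → Exec P s s' t → Exec (.cond e P Q) s s' (e.cost + 1 + t)
  | condFalse {e : Expr} {P Q : Prog} {s s' : Memory} {t : ℕ} :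
      e.val s = 0 → Exec Q s s' t → Exec (.cond e P Q) s s' (e.cost + 1 + t)
  | loopTrue {e : Expr} {P : Prog} {s s' s'' : Memory} {t t' : ℕ} :
      e.val s ≠ 0 → Exec P s s' t → Exec (.loop e P) s' s'' t' →
        Exec (.loop e P) s s'' (e.cost + 1 + t + t')
  | loopFalse {e : Expr} {P : Prog} {s : Memory} :
      e.val s = 0 → Exec (.loop e P) s s (e.cost + 1)

/-- The initial memory: the input is in array `0`, everything else is zero. -/
def initMemory (l : List ℕ) : Memory where
  reg := fun _ => 0
  arr := fun a i => if a = 0 then l.getD i 0 else 0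

/-- The output of a computation is read from the beginning of array `1`. -/
def HasOutput (s : Memory) (l : List ℕ) : Prop := ∀ i (h : i < l.length), s.arr 1 i = l[i]

/-- `f` is computable in polynomial time: one program computes `f` on every input, in a number of
steps that is polynomial in the number of words of the input. -/
def PolyTimeComputable (f : Instance → Instance) : Prop :=
  ∃ (P : Prog) (T : Polynomial ℕ), ∀ I : Instance, ∃ (s : Memory) (t : ℕ),
    Exec P (initMemory I.encode) s t ∧ t ≤ T.eval I.encode.length ∧ HasOutput s (f I).encode

/-- `L`, parameterized by `p = n - k`, admits a kernel with at most `b p` vertices: a polynomial-time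
algorithm transforms every instance `(G, k)` into an equivalent instance `(G', k')` such that both the
number of vertices of `G'` and `k'` are at most `b p`. (So the size of `(G', k')`, and its parameter,
are bounded in terms of `p`.) -/
def AdmitsKernel (L : Set Instance) (b : ℕ → ℕ) : Prop :=
  ∃ K : Instance → Instance, PolyTimeComputable K ∧
    ∀ I : Instance, (K I ∈ L ↔ I ∈ L) ∧ (K I).n ≤ b I.dualParam ∧ (K I).k ≤ b I.dualParam

end VertexIdentification

/-! ### Identification sequences as surjective colourings. -/

namespace VertexIdentification

/-! Successive identifications only merge vertices. So at most `k` of them lead into the class iff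
there is a surjective colouring with some `q ≥ n - k` colours whose quotient graph lies in the class
(`canIdentifyInto_iff`). For cluster graphs, label each colour by its component: edges preserve
labels, and distinct colours with equal labels must be joined by a witness edge. Complete graphs are
the case of a single label, so `HasColouring` serves both problems. Surplus colours can be merged
(`HasColouring.mono`), hence only `q = p` matters.

Let `D = 4p² + 1`, and choose greedily a set `E` of edges with maximum degree at most `D` and at
most `D²` members. If `E` reaches size `D²`, it contains disjoint edges for all `p²` ordered pairs
of colours, and the answer is yes. Otherwise `E` is saturated: every edge outside `E` has an end of
`E`-degree at least `D`.

In the saturated case a solution for `G` needs witnesses for at most `p²` pairs, which occupy at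
most `2p²` vertices. A witness outside `E` has an end `x` of large degree, and `x` has an
`E`-neighbour `w` that no witness uses. Recolouring `w` moves the witness into `E` and keeps all
labels, because `w` has the label of `x` (`IsSaturated.exists_recolouring`). Thus the ends of `E`
suffice for the witnesses. Conversely, all neighbours of a dropped vertex have large degree and are
kept; the vertex takes the colour of one of them. Its other neighbours have the same label, because
for any two large-degree vertices with a common neighbour one such neighbour is kept
(`IsKernelMap.hasColouring_iff`).

A colour alone with its label has no witness, so it could be lost with dropped isolated vertices.
For clusters, if an isolated vertex is dropped, then `p` isolated ones remain and both instances are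
yes. There are at most `2D²` ends of `E`, hence at most `2D` vertices of large degree and at most
`(2D)²` chosen common neighbours; this gives `O(p⁴)`.

The program is verified by loop invariants in which `E` and the choice `w` of common neighbours are
ghost objects: only degrees, a counter and marks are stored. -/

/-- The quotient of a graph by a colouring: colours are adjacent if an edge joins their classes. -/
def quotientGraph {V W : Type} (G : SimpleGraph V) (f : V → W) : SimpleGraph W where
  Adj a b := a ≠ b ∧ ∃ x y, f x = a ∧ f y = b ∧ G.Adj x y
  symm := ⟨by
    rintro a b ⟨h, x, y, hx, hy, hxy⟩
    exact ⟨h.symm, y, x, hy, hx, hxy.symm⟩⟩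
  loopless := ⟨fun _ h => h.1 rfl⟩

lemma quotientGraph_identify {V W : Type} (G : SimpleGraph V) (f : V → W) {u v : V} (huv : u ≠ v)
    (h : f u = f v) :
    quotientGraph (identify G u v) (fun x => f x.1) = quotientGraph G f := by
  ext a b
  constructor
  · rintro ⟨hab, x, y, rfl, rfl, -, hxy | ⟨hx, hxy⟩ | ⟨hy, hxy⟩⟩
    · exact ⟨hab, x.1, y.1, rfl, rfl, hxy⟩
    · exact ⟨hab, v, y.1, h.symm.trans (congrArg f hx.symm), rfl, hxy⟩
    · exact ⟨hab, x.1, v, rfl, h.symm.trans (congrArg f hy.symm), hxy⟩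
  · rintro ⟨hab, x, y, rfl, rfl, hxy⟩
    refine ⟨hab, ?_⟩
    by_cases hx : x = v
    · have hy : y ≠ v := by rintro rfl; exact hab (by rw [hx])
      refine ⟨⟨u, huv⟩, ⟨y, hy⟩, h.trans (congrArg f hx.symm), rfl, ?_, Or.inr (Or.inl ⟨rfl, hx ▸ hxy⟩)⟩
      intro he
      have : u = y := congrArg Subtype.val he
      exact hab (by rw [hx, ← this, h])
    · by_cases hy : y = v
      · refine ⟨⟨x, hx⟩, ⟨u, huv⟩, rfl, h.trans (congrArg f hy.symm), ?_, Or.inr (Or.inr ⟨rfl, hy ▸ hxy⟩)⟩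
        intro he
        have : x = u := congrArg Subtype.val he
        exact hab (by rw [hy, this, h])
      · refine ⟨⟨x, hx⟩, ⟨y, hy⟩, rfl, rfl, ?_, Or.inl hxy⟩
        intro he
        exact hab (congrArg (fun z => f z.1) he)

/-- A class of graphs that is closed under isomorphism. -/
def GraphClass.IsoInvariant (H : GraphClass) : Prop :=
  ∀ (V W : Type) (G : SimpleGraph V) (e : V ≃ W), H V G ↔ H W (quotientGraph G e)

/-- Induction on `k`: identifying two vertices of one colour leaves the quotient unchanged, and a
colouring after the identification extends to `v` by the colour of `u`. When no two vertices share a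
colour, the colouring is a bijection and isomorphism invariance applies. -/
lemma canIdentifyInto_iff {H : GraphClass} (hH : H.IsoInvariant) (k : ℕ) (V : Type) [Finite V]
    (G : SimpleGraph V) :
    CanIdentifyInto H k V G ↔ ∃ (q : ℕ) (f : V → Fin q), Function.Surjective f ∧
      Nat.card V ≤ q + k ∧ H (Fin q) (quotientGraph G f) := by
  have base : ∀ (V : Type) [Finite V] (G : SimpleGraph V) (k : ℕ), H V G →
      ∃ (q : ℕ) (f : V → Fin q), Function.Surjective f ∧
        Nat.card V ≤ q + k ∧ H (Fin q) (quotientGraph G f) := fun V _ G k h =>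
    ⟨Nat.card V, Finite.equivFin V, (Finite.equivFin V).surjective, Nat.le_add_right _ _,
      (hH _ _ _ _).1 h⟩
  have inj : ∀ (V : Type) [Finite V] (G : SimpleGraph V) (q : ℕ) (f : V → Fin q),
      Function.Surjective f → Function.Injective f → H (Fin q) (quotientGraph G f) → H V G :=
    fun V _ G q f hs hi h => (hH _ _ G (Equiv.ofBijective f ⟨hi, hs⟩)).2 h
  induction k generalizing V with
  | zero =>
    refine ⟨base V G 0, ?_⟩
    rintro ⟨q, f, hs, hc, h⟩
    refine inj V G q f hs ?_ h
    have hq : Nat.card V = Nat.card (Fin q) :=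
      le_antisymm (by simpa using hc) (Nat.card_le_card_of_surjective f hs)
    exact ((Nat.bijective_iff_surjective_and_card f).2 ⟨hs, hq⟩).1
  | succ k ih =>
    have hcard : ∀ v : V, Nat.card {x : V // x ≠ v} + 1 = Nat.card V := by
      classical
      intro v
      have := Fintype.ofFinite V
      rw [Nat.card_eq_fintype_card, Nat.card_eq_fintype_card, Fintype.card_subtype_compl,
        Fintype.card_subtype_eq]
      have : 0 < Fintype.card V := Fintype.card_pos_iff.2 ⟨v⟩
      omega
    constructor
    · rintro (h | ⟨u, v, huv, h⟩)
      · exact base V G _ h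
      · obtain ⟨q, f, hs, hc, h⟩ := (ih _ _).1 h
        classical
        have hf : (fun x : {x : V // x ≠ v} =>
            (fun y : V => if hy : y = v then f ⟨u, huv⟩ else f ⟨y, hy⟩) x.1) = f := by
          funext x
          exact dif_neg x.2
        refine ⟨q, fun y => if hy : y = v then f ⟨u, huv⟩ else f ⟨y, hy⟩, ?_, ?_, ?_⟩
        · intro a
          obtain ⟨x, hx⟩ := hs a
          exact ⟨x.1, (congrFun hf x).trans hx⟩
        · have := hcard v
          omega
        · rw [← quotientGraph_identify G _ huv (by simp [huv]), hf]
          exact h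
    · rintro ⟨q, f, hs, hc, h⟩
      by_cases hi : Function.Injective f
      · exact Or.inl (inj V G q f hs hi h)
      · obtain ⟨u, v, huv, hne⟩ : ∃ u v, f u = f v ∧ u ≠ v := by
          simpa [Function.Injective] using hi
        refine Or.inr ⟨u, v, hne, (ih _ _).2 ⟨q, fun x => f x.1, ?_, ?_, ?_⟩⟩
        · intro a
          obtain ⟨x, hx⟩ := hs a
          by_cases hxv : x = v
          · exact ⟨⟨u, hne⟩, by rw [← hx, hxv, ← huv]⟩
          · exact ⟨⟨x, hxv⟩, hx⟩
        · have := hcard v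
          omega
        · rwa [quotientGraph_identify G f hne huv]

/-- A surjective colouring with `q` colours, and labels of the colours, such that edges join
vertices with the same label, and different colours with the same label are joined by an edge. -/
def HasColouring {V : Type} (L : Type) (G : SimpleGraph V) (q : ℕ) : Prop :=
  ∃ (f : V → Fin q) (c : Fin q → L), Function.Surjective f ∧
    (∀ x y, G.Adj x y → c (f x) = c (f y)) ∧
    ∀ a b, a ≠ b → c a = c b → ∃ x y, f x = a ∧ f y = b ∧ G.Adj x y

lemma completeGraphs_iff {V : Type} (G : SimpleGraph V) :
    completeGraphs V G ↔ ∀ a b, a ≠ b → G.Adj a b := by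
  simp [completeGraphs, SimpleGraph.IsClique, Set.Pairwise]

lemma clusterGraphs_iff {V : Type} (G : SimpleGraph V) :
    clusterGraphs V G ↔ ∀ a b, G.Reachable a b → a ≠ b → G.Adj a b := by
  constructor
  · intro h a b hab hne
    exact h (G.connectedComponentMk b) (by simpa using hab) (by simp) hne
  · intro h C a ha b hb hne
    refine h a b ?_ hne
    rw [SimpleGraph.ConnectedComponent.mem_supp_iff] at ha hb
    exact SimpleGraph.ConnectedComponent.exact (ha.trans hb.symm)

/-- The isomorphism from a graph to its quotient by a bijection. -/
def isoQuotientGraph {V W : Type} (G : SimpleGraph V) (e : V ≃ W) : G ≃g quotientGraph G e where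
  toEquiv := e
  map_rel_iff' := by
    intro a b
    constructor
    · rintro ⟨-, x, y, hx, hy, h⟩
      rwa [← e.injective hx, ← e.injective hy]
    · intro h
      exact ⟨e.injective.ne h.ne, a, b, rfl, rfl, h⟩

lemma completeGraphs_isoInvariant : GraphClass.IsoInvariant completeGraphs := by
  intro V W G e
  rw [completeGraphs_iff, completeGraphs_iff, e.symm.forall_congr_left]
  refine forall_congr' fun a => ?_
  rw [e.symm.forall_congr_left]
  refine forall_congr' fun b => ?_
  have := (isoQuotientGraph G e).map_adj_iff (v := a) (w := b)
  simp only [isoQuotientGraph, RelIso.coe_fn_mk] at this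
  simp [this]

lemma clusterGraphs_isoInvariant : GraphClass.IsoInvariant clusterGraphs := by
  intro V W G e
  rw [clusterGraphs_iff, clusterGraphs_iff, e.symm.forall_congr_left]
  refine forall_congr' fun a => ?_
  rw [e.symm.forall_congr_left]
  refine forall_congr' fun b => ?_
  have h₁ := (isoQuotientGraph G e).map_adj_iff (v := a) (w := b)
  have h₂ := (isoQuotientGraph G e).reachable_iff (u := a) (v := b)
  simp only [isoQuotientGraph, RelIso.coe_fn_mk] at h₁ h₂
  simp [h₁, h₂]

/-- The labels number the connected components; conversely, labels are constant along walks. -/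
lemma exists_labels_iff_clusterGraphs {W : Type} [Finite W] (Q : SimpleGraph W) :
    clusterGraphs W Q ↔ ∃ c : W → ℕ, (∀ a b, Q.Adj a b → c a = c b) ∧
      ∀ a b, a ≠ b → c a = c b → Q.Adj a b := by
  rw [clusterGraphs_iff]
  constructor
  · intro h
    obtain ⟨i, hi⟩ := exists_injective_nat Q.ConnectedComponent
    refine ⟨fun a => i (Q.connectedComponentMk a), ?_, ?_⟩
    · intro a b hab
      exact congrArg i (SimpleGraph.ConnectedComponent.sound hab.reachable)
    · intro a b hne hab
      exact h a b (SimpleGraph.ConnectedComponent.exact (hi hab)) hne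
  · rintro ⟨c, h₁, h₂⟩ a b ⟨w⟩ hne
    refine h₂ a b hne ?_
    clear hne
    induction w with
    | nil => rfl
    | cons h _ ih => exact (h₁ _ _ h).trans ih

lemma mem_cliqueIdentification_iff (I : Instance) :
    I ∈ CliqueIdentification ↔ ∃ q, I.n ≤ q + I.k ∧ HasColouring Unit I.G q := by
  change CanIdentifyInto _ _ _ _ ↔ _
  rw [canIdentifyInto_iff completeGraphs_isoInvariant]
  refine exists_congr fun q => ?_
  simp only [completeGraphs_iff, Nat.card_fin, HasColouring]
  constructor
  · rintro ⟨f, hs, hn, h⟩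
    exact ⟨hn, f, fun _ => (), hs, fun _ _ _ => trivial, fun a b hab _ => (h a b hab).2⟩
  · rintro ⟨hn, f, c, hs, -, h⟩
    exact ⟨f, hs, hn, fun a b hab => ⟨hab, h a b hab trivial⟩⟩

lemma mem_clusterIdentification_iff (I : Instance) :
    I ∈ ClusterIdentification ↔ ∃ q, I.n ≤ q + I.k ∧ HasColouring ℕ I.G q := by
  change CanIdentifyInto _ _ _ _ ↔ _
  rw [canIdentifyInto_iff clusterGraphs_isoInvariant]
  refine exists_congr fun q => ?_
  simp only [exists_labels_iff_clusterGraphs, Nat.card_fin, HasColouring]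
  constructor
  · rintro ⟨f, hs, hn, c, h₁, h₂⟩
    refine ⟨hn, f, c, hs, fun x y hxy => ?_, fun a b hab h => (h₂ a b hab h).2⟩
    by_cases h : f x = f y
    · rw [h]
    · exact h₁ _ _ ⟨h, x, y, rfl, rfl, hxy⟩
  · rintro ⟨hn, f, c, hs, h₁, h₂⟩
    refine ⟨f, hs, hn, c, ?_, fun a b hab h => ⟨hab, h₂ a b hab h⟩⟩
    rintro _ _ ⟨-, x, y, rfl, rfl, h⟩
    exact h₁ x y h

/-- Superfluous colours can be merged. -/
lemma HasColouring.mono {V L : Type} {G : SimpleGraph V} {p q : ℕ} (hp : 0 < p) (hpq : p ≤ q)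
    (h : HasColouring L G q) : HasColouring L G p := by
  classical
  obtain ⟨f, c, hs, h₁, h₂⟩ := h
  let j : Fin p → Fin q := Fin.castLE hpq
  -- The first `p` colours stay. Any other colour joins one of these with its own label if possible,
  -- and colour `0` otherwise.
  let g : Fin q → Fin p := fun a =>
    if h : ∃ b, j b = a then h.choose else
      if h : ∃ b, c (j b) = c a then h.choose else ⟨0, hp⟩
  have hj : Function.Injective j := Fin.castLE_injective hpq
  have hg : ∀ b, g (j b) = b := by
    intro b
    have h : ∃ b', j b' = j b := ⟨b, rfl⟩
    simp only [g, dif_pos h]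
    exact hj h.choose_spec
  -- The new label depends only on the old label, so edges still join equal labels.
  have hc : ∀ a, c (j (g a)) = if ∃ b, c (j b) = c a then c a else c (j ⟨0, hp⟩) := by
    intro a
    by_cases h : ∃ b, j b = a
    · obtain ⟨b, rfl⟩ := h
      rw [hg, if_pos ⟨b, rfl⟩]
    · by_cases h' : ∃ b, c (j b) = c a
      · simp only [g, dif_neg h, dif_pos h', if_pos h']
        exact h'.choose_spec
      · simp only [g, dif_neg h, dif_neg h', if_neg h']
  refine ⟨fun x => g (f x), fun b => c (j b), ?_, ?_, ?_⟩
  · intro b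
    obtain ⟨x, hx⟩ := hs (j b)
    exact ⟨x, (congrArg g hx).trans (hg b)⟩
  · intro x y hxy
    change c (j (g (f x))) = c (j (g (f y)))
    rw [hc, hc, h₁ x y hxy]
  · intro a b hab h
    obtain ⟨x, y, hx, hy, hxy⟩ := h₂ (j a) (j b) (hj.ne hab) h
    exact ⟨x, y, (congrArg g hx).trans (hg a), (congrArg g hy).trans (hg b), hxy⟩

/-- Merging reduces `q` to exactly `p` when `p > 0`. For `p = 0` the answer is always yes, with one
colour, or none if the graph is empty. -/
lemma exists_hasColouring_iff {L : Type} [Nonempty L] (I : Instance) :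
    (∃ q, I.n ≤ q + I.k ∧ HasColouring L I.G q) ↔
      I.dualParam = 0 ∨ HasColouring L I.G I.dualParam := by
  unfold Instance.dualParam
  constructor
  · rintro ⟨q, hn, hq⟩
    rcases Nat.eq_zero_or_pos (I.n - I.k) with h | h
    · exact Or.inl h
    · exact Or.inr (hq.mono h (by omega))
  · rintro (h | h)
    · obtain ⟨l⟩ := ‹Nonempty L›
      rcases Nat.eq_zero_or_pos I.n with hn | hn
      · have : IsEmpty (Fin I.n) := by rw [hn]; infer_instance
        exact ⟨0, by omega, fun x => isEmptyElim x, fun _ => l, fun a => a.elim0,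
          fun x => isEmptyElim x, fun a => a.elim0⟩
      · refine ⟨1, by omega, fun _ => 0, fun _ => l, fun a => ⟨⟨0, hn⟩, Subsingleton.elim _ _⟩,
          fun _ _ _ => rfl, fun a b hab => absurd (Subsingleton.elim a b) hab⟩
    · exact ⟨_, by omega, h⟩


/-! ### Equivalence of a graph and its kernel. -/

section Kernel

variable {V : Type} [DecidableEq V]

/-- The number of pairs of `E` that contain `x`. -/
def pairDegree (E : Finset (V × V)) (x : V) : ℕ := (E.filter fun e => e.1 = x ∨ e.2 = x).card

lemma pairDegree_pos_left {E : Finset (V × V)} {x y : V} (h : (x, y) ∈ E) : 0 < pairDegree E x :=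
  Finset.card_pos.2 ⟨(x, y), by simp [h]⟩

lemma pairDegree_pos_right {E : Finset (V × V)} {x y : V} (h : (x, y) ∈ E) : 0 < pairDegree E y :=
  Finset.card_pos.2 ⟨(x, y), by simp [h]⟩

lemma pairDegree_mono {E F : Finset (V × V)} (h : E ⊆ F) (x : V) :
    pairDegree E x ≤ pairDegree F x :=
  Finset.card_le_card (Finset.filter_subset_filter _ h)

/-- If `E` has many edges and small maximum degree, then the vertices can be coloured so that all
pairs of colours in `s` appear on edges of `E`. -/
lemma exists_colouring_of_card_le {C : Type} [DecidableEq C] [Nonempty C] {D : ℕ} (hD : 0 < D)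
    (s : Finset (C × C)) (E : Finset (V × V)) (hE : ∀ e ∈ E, e.1 ≠ e.2)
    (hdeg : ∀ x, pairDegree E x ≤ D) (hs : 2 * D * s.card ≤ E.card) :
    ∃ f : V → C, ∀ q ∈ s, ∃ e ∈ E, f e.1 = q.1 ∧ f e.2 = q.2 := by
  induction s using Finset.induction_on generalizing E with
  | empty => exact ⟨fun _ => Classical.arbitrary C, by simp⟩
  | insert q s hq ih =>
    rw [Finset.card_insert_of_notMem hq] at hs
    obtain ⟨e, he⟩ : E.Nonempty := by
      rw [← Finset.card_pos]
      have : 0 < 2 * D * (s.card + 1) := by positivity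
      omega
    -- The pairs that meet `e` number at most `2 * D`, the budget of one pair of colours. Later
    -- witnesses avoid both ends of `e`, which can therefore be coloured freely.
    set R := (E.filter fun e' => e'.1 = e.1 ∨ e'.2 = e.1) ∪
      (E.filter fun e' => e'.1 = e.2 ∨ e'.2 = e.2) with hR
    set F := E \ R with hF
    have hFE : F ⊆ E := Finset.sdiff_subset
    have hcard : E.card ≤ F.card + 2 * D := by
      have h₁ : E.card ≤ F.card + R.card := Finset.card_le_card_sdiff_add_card
      have h₂ : R.card ≤ pairDegree E e.1 + pairDegree E e.2 := Finset.card_union_le _ _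
      have h₃ := hdeg e.1
      have h₄ := hdeg e.2
      omega
    obtain ⟨f, hf⟩ := ih F (fun e' h => hE e' (hFE h))
      (fun x => (pairDegree_mono hFE x).trans (hdeg x)) (by rw [mul_add] at hs; omega)
    have hne := hE e he
    refine ⟨Function.update (Function.update f e.1 q.1) e.2 q.2, fun r hr => ?_⟩
    rcases Finset.mem_insert.1 hr with rfl | hr
    · exact ⟨e, he, by simp [hne], by simp⟩
    · obtain ⟨e', he', h₁, h₂⟩ := hf r hr
      have hR' := (Finset.mem_sdiff.1 he').2
      simp only [hR, Finset.mem_union, Finset.mem_filter, hFE he', true_and] at hR'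
      push Not at hR'
      obtain ⟨⟨h₃, h₄⟩, h₅, h₆⟩ := hR'
      exact ⟨e', hFE he', by simp [h₃, h₅, h₁], by simp [h₄, h₆, h₂]⟩

/-- A vertex of large degree has a neighbour outside any small set. -/
lemma exists_neighbour_notMem {E : Finset (V × V)} {x : V} {U : Finset V}
    (hU : 2 * U.card < pairDegree E x) : ∃ w ∉ U, (x, w) ∈ E ∨ (w, x) ∈ E := by
  by_contra! h
  have hsub : (E.filter fun e => e.1 = x ∨ e.2 = x) ⊆
      (U.image fun w => (x, w)) ∪ (U.image fun w => (w, x)) := by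
    rintro ⟨a, b⟩ hab
    simp only [Finset.mem_filter, Finset.mem_union, Finset.mem_image, Prod.mk.injEq] at hab ⊢
    obtain ⟨hab, rfl | rfl⟩ := hab
    · exact Or.inl ⟨b, by_contra fun hb => (h b hb).1 hab, rfl, rfl⟩
    · exact Or.inr ⟨a, by_contra fun ha => (h a ha).2 hab, rfl, rfl⟩
  have h₁ : pairDegree E x ≤ _ := Finset.card_le_card hsub
  have h₂ := Finset.card_union_le (U.image fun w => (x, w)) (U.image fun w => (w, x))
  have h₃ : (U.image fun w => (x, w)).card ≤ U.card := Finset.card_image_le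
  have h₄ : (U.image fun w => (w, x)).card ≤ U.card := Finset.card_image_le
  omega

/-- The pairs `E` are edges of `G`, form a graph of maximum degree at most `D`, and every other edge
of `G` has an end of degree `D`. -/
structure IsSaturated (G : SimpleGraph V) (D : ℕ) (E : Finset (V × V)) : Prop where
  adj : ∀ e ∈ E, G.Adj e.1 e.2
  saturated : ∀ x y, G.Adj x y → (x, y) ∈ E ∨ (y, x) ∈ E ∨ D ≤ pairDegree E x ∨ D ≤ pairDegree E y

/-- Vertices can be recoloured, without a change of labels, so that the edges that witness the
adjacency of colours belong to a given saturated set of edges. -/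
lemma IsSaturated.exists_recolouring {G : SimpleGraph V} {D : ℕ} {E : Finset (V × V)}
    (hE : IsSaturated G D E) {C L : Type} [DecidableEq C] (c : C → L) (s : Finset (C × C))
    (hs : 4 * s.card < D) (hc : ∀ q ∈ s, c q.1 = c q.2) (f : V → C)
    (hl : ∀ x y, G.Adj x y → c (f x) = c (f y))
    (hf : ∀ q ∈ s, ∃ x y, f x = q.1 ∧ f y = q.2 ∧ G.Adj x y) :
    ∃ f' : V → C, (∀ x, c (f' x) = c (f x)) ∧
      ∀ q ∈ s, ∃ x y, f' x = q.1 ∧ f' y = q.2 ∧ ((x, y) ∈ E ∨ (y, x) ∈ E) := by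
  classical
  -- A function `g` selects one witness per pair of colours; the induction is on the number of
  -- witnesses outside `E`.
  let good : (C × C → V × V) → C × C → Prop := fun g q => g q ∈ E ∨ (g q).swap ∈ E
  rcases isEmpty_or_nonempty V with hV | hV
  · exact ⟨f, fun _ => rfl, fun q hq => isEmptyElim (hf q hq).choose⟩
  suffices H : ∀ (m : ℕ) (f : V → C) (g : C × C → V × V),
      (∀ x y, G.Adj x y → c (f x) = c (f y)) →
      (∀ q ∈ s, f (g q).1 = q.1 ∧ f (g q).2 = q.2 ∧ G.Adj (g q).1 (g q).2) →
      (s.filter fun q => ¬ good g q).card = m →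
      ∃ f' : V → C, (∀ x, c (f' x) = c (f x)) ∧
        ∀ q ∈ s, ∃ x y, f' x = q.1 ∧ f' y = q.2 ∧ ((x, y) ∈ E ∨ (y, x) ∈ E) by
    have hg : ∀ q, ∃ e : V × V, q ∈ s → f e.1 = q.1 ∧ f e.2 = q.2 ∧ G.Adj e.1 e.2 := by
      intro q
      by_cases hq : q ∈ s
      · obtain ⟨x, y, h⟩ := hf q hq
        exact ⟨(x, y), fun _ => h⟩
      · exact ⟨Classical.arbitrary _, fun h => absurd h hq⟩
    choose g hg using hg
    exact H _ f g hl hg rfl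
  intro m
  induction m with
  | zero =>
    intro f g hl hg hm
    refine ⟨f, fun _ => rfl, fun q hq => ⟨(g q).1, (g q).2, (hg q hq).1, (hg q hq).2.1, ?_⟩⟩
    rw [Finset.card_eq_zero, Finset.filter_eq_empty_iff] at hm
    exact not_not.1 (hm hq)
  | succ m ih =>
    intro f g hl hg hm
    obtain ⟨q, hq⟩ : (s.filter fun q => ¬ good g q).Nonempty := by
      rw [← Finset.card_pos]; omega
    obtain ⟨hqs, hqg⟩ := Finset.mem_filter.1 hq
    set U : Finset V := (s.image fun r => (g r).1) ∪ (s.image fun r => (g r).2) with hU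
    have hU₁ : ∀ r ∈ s, (g r).1 ∈ U := fun r hr =>
      Finset.mem_union_left _ (Finset.mem_image_of_mem _ hr)
    have hU₂ : ∀ r ∈ s, (g r).2 ∈ U := fun r hr =>
      Finset.mem_union_right _ (Finset.mem_image_of_mem _ hr)
    have hUc : U.card ≤ 2 * s.card := by
      have h₁ : U.card ≤ _ + _ := Finset.card_union_le _ _
      have h₂ : (s.image fun r => (g r).1).card ≤ s.card := Finset.card_image_le
      have h₃ : (s.image fun r => (g r).2).card ≤ s.card := Finset.card_image_le
      omega
    -- an unused vertex `w` takes the colour `b`, and `e` becomes the witness for `q`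
    have step : ∀ (w : V) (b : C) (e : V × V), w ∉ U → c b = c (f w) →
        Function.update f w b e.1 = q.1 → Function.update f w b e.2 = q.2 →
        G.Adj e.1 e.2 → (e ∈ E ∨ e.swap ∈ E) →
        ∃ f' : V → C, (∀ x, c (f' x) = c (f x)) ∧
          ∀ q ∈ s, ∃ x y, f' x = q.1 ∧ f' y = q.2 ∧ ((x, y) ∈ E ∨ (y, x) ∈ E) := by
      intro w b e hw hb h₁ h₂ he heE
      have hc' : ∀ x, c (Function.update f w b x) = c (f x) := by
        intro x
        by_cases hx : x = w
        · subst hx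
          simpa using hb
        · simp [hx]
      obtain ⟨f', hf', h⟩ := ih (Function.update f w b) (Function.update g q e)
        (fun x y h => by rw [hc', hc', hl x y h]) (by
        intro r hr
        by_cases hrq : r = q
        · subst hrq
          simpa using ⟨h₁, h₂, he⟩
        · have hw₁ : (g r).1 ≠ w := fun h => hw (h ▸ hU₁ r hr)
          have hw₂ : (g r).2 ≠ w := fun h => hw (h ▸ hU₂ r hr)
          simpa [hrq, hw₁, hw₂] using hg r hr) (by
        have : (s.filter fun r => ¬ good (Function.update g q e) r) =
            (s.filter fun r => ¬ good g r).erase q := by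
          ext r
          by_cases hrq : r = q
          · subst hrq
            simpa [good] using fun _ h => heE.resolve_left h
          · simp [good, hrq]
        rw [this, Finset.card_erase_of_mem hq]
        omega)
      exact ⟨f', fun x => (hf' x).trans (hc' x), h⟩
    obtain ⟨h₁, h₂, h₃⟩ := hg q hqs
    have hadj : ∀ {x y}, (x, y) ∈ E ∨ (y, x) ∈ E → G.Adj x y := fun h =>
      h.elim (fun h => hE.adj _ h) (fun h => (hE.adj _ h).symm)
    have hne : ∀ {r w}, r ∈ U → w ∉ U → r ≠ w := fun hr hw h => hw (h ▸ hr)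
    have hq' := hc q hqs
    rcases hE.saturated _ _ h₃ with h | h | h | h
    · exact absurd (Or.inl h) hqg
    · exact absurd (Or.inr h) hqg
    -- Here `2 * U.card ≤ 4 * s.card < D`. The new vertex `w` replaces the second end of the
    -- witness; its label is that of `(g q).1`, hence that of `q.2`.
    · obtain ⟨w, hw, hwE⟩ := exists_neighbour_notMem (E := E) (x := (g q).1) (U := U) (by omega)
      refine step w q.2 ((g q).1, w) hw ?_ ?_ (by simp) (hadj hwE) hwE
      · rw [← hl _ _ (hadj hwE), h₁, hq']
      · simpa [hne (hU₁ q hqs) hw] using h₁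
    · obtain ⟨w, hw, hwE⟩ := exists_neighbour_notMem (E := E) (x := (g q).2) (U := U) (by omega)
      refine step w q.1 (w, (g q).2) hw ?_ (by simp) ?_ (hadj hwE).symm hwE.symm
      · rw [← hl _ _ (hadj hwE), h₂, hq']
      · simpa [hne (hU₂ q hqs) hw] using h₂

/-- What the kernelization provides: a map `φ` onto a set of vertices that contains all vertices of
positive degree in `E`, and a common neighbour for any two vertices of large degree that have one. -/
structure IsKernelMap {V' : Type} (G : SimpleGraph V) (D : ℕ) (E : Finset (V × V)) (φ : V' → V) :
    Prop where
  injective : Function.Injective φ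
  adj : ∀ e ∈ E, G.Adj e.1 e.2
  mem_range : ∀ x, 0 < pairDegree E x → x ∈ Set.range φ
  common : ∀ x y v, D ≤ pairDegree E x → D ≤ pairDegree E y → G.Adj x v → G.Adj y v →
    ∃ w ∈ Set.range φ, G.Adj x w ∧ G.Adj y w

lemma hasColouring_comap {V V' L : Type} {G : SimpleGraph V} {φ : V' → V} {p : ℕ} {f : V → Fin p}
    {c : Fin p → L} (hs : Function.Surjective (f ∘ φ))
    (hl : ∀ x y, G.Adj x y → c (f x) = c (f y))
    (h : ∀ a b, a ≠ b → c a = c b →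
      ∃ x y, x ∈ Set.range φ ∧ y ∈ Set.range φ ∧ f x = a ∧ f y = b ∧ G.Adj x y) :
    HasColouring L (G.comap φ) p := by
  refine ⟨f ∘ φ, c, hs, fun x y hxy => hl _ _ hxy, fun a b hab hc => ?_⟩
  obtain ⟨_, _, ⟨x, rfl⟩, ⟨y, rfl⟩, hx, hy, hxy⟩ := h a b hab hc
  exact ⟨x, y, hx, hy, hxy⟩

/-- A graph with many edges and small maximum degree can be coloured with a single label. -/
lemma IsKernelMap.hasColouring_of_card_le {V' L : Type} [Nonempty L] {G : SimpleGraph V} {D : ℕ}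
    {E : Finset (V × V)} {φ : V' → V} (hφ : IsKernelMap G D E φ) {p : ℕ} (hp : 0 < p)
    (hdeg : ∀ x, pairDegree E x ≤ D) (hD : 4 * p ^ 2 < D) (hE : D ^ 2 ≤ E.card) :
    HasColouring L (G.comap φ) p := by
  have : Nonempty (Fin p) := ⟨⟨0, hp⟩⟩
  -- All ordered pairs are demanded, including the diagonal ones, which give surjectivity also for
  -- `p = 1`. The size suffices because `2 * D * p ^ 2 ≤ D ^ 2`.
  obtain ⟨f, hf⟩ := exists_colouring_of_card_le (by omega) (Finset.univ : Finset (Fin p × Fin p)) E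
    (fun e he => (hφ.adj e he).ne) hdeg (by
      rw [Finset.card_univ, Fintype.card_prod, Fintype.card_fin]
      nlinarith)
  obtain ⟨l⟩ := ‹Nonempty L›
  have key : ∀ a b, ∃ x y, x ∈ Set.range φ ∧ y ∈ Set.range φ ∧ f x = a ∧ f y = b ∧ G.Adj x y := by
    intro a b
    obtain ⟨e, he, h₁, h₂⟩ := hf (a, b) (Finset.mem_univ _)
    exact ⟨e.1, e.2, hφ.mem_range _ (pairDegree_pos_left he),
      hφ.mem_range _ (pairDegree_pos_right he), h₁, h₂, hφ.adj e he⟩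
  refine hasColouring_comap (c := fun _ => l) ?_ (fun _ _ _ => rfl) (fun a b _ _ => key a b)
  intro a
  obtain ⟨_, _, ⟨x, rfl⟩, -, hx, -⟩ := key a a
  exact ⟨x, hx⟩

/-- Isolated vertices give a colouring with different labels. -/
lemma hasColouring_of_isolated {V : Type} {G : SimpleGraph V} {p : ℕ} (hp : 0 < p) (i : Fin p → V)
    (hi : Function.Injective i) (h : ∀ a y, ¬ G.Adj (i a) y) : HasColouring ℕ G p := by
  classical
  refine ⟨fun x => if h : ∃ a, i a = x then h.choose else ⟨0, hp⟩, Fin.val, ?_, ?_, ?_⟩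
  · intro a
    refine ⟨i a, ?_⟩
    have ha : ∃ b, i b = i a := ⟨a, rfl⟩
    simpa only [dif_pos ha] using hi ha.choose_spec
  · intro x y hxy
    dsimp only
    rw [dif_neg, dif_neg]
    · rintro ⟨a, rfl⟩
      exact h a x hxy.symm
    · rintro ⟨a, rfl⟩
      exact h a y hxy
  · intro a b hab h
    exact absurd (Fin.ext h) hab

/-- The kernel is equivalent if the chosen edges form a saturated set. -/
lemma IsKernelMap.hasColouring_iff {V' L : Type} {G : SimpleGraph V} {D : ℕ}
    {E : Finset (V × V)} {φ : V' → V} (hφ : IsKernelMap G D E φ) {p : ℕ} (hp : 0 < p)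
    (hD : 4 * p ^ 2 < D) (hE : IsSaturated G D E)
    (hL : (∀ x, (∀ y, ¬ G.Adj x y) → x ∈ Set.range φ) ∨ Subsingleton L ∧ Nonempty V') :
    HasColouring L (G.comap φ) p ↔ HasColouring L G p := by
  classical
  have hout : ∀ x y, G.Adj x y → x ∉ Set.range φ → D ≤ pairDegree E y ∧ y ∈ Set.range φ := by
    intro x y hxy hx
    have h : D ≤ pairDegree E y := by
      rcases hE.saturated x y hxy with h | h | h | h
      · exact absurd (hφ.mem_range _ (pairDegree_pos_left h)) hx
      · exact absurd (hφ.mem_range _ (pairDegree_pos_right h)) hx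
      · exact absurd (hφ.mem_range _ (by omega)) hx
      · exact h
    exact ⟨h, hφ.mem_range _ (by omega)⟩
  constructor
  · rintro ⟨f, c, hs, h₁, h₂⟩
    -- A dropped vertex copies a kept neighbour. The default colour occurs only at dropped isolated
    -- vertices, which no edge can contradict.
    let F : V → Fin p := fun x => if h : ∃ w, φ w = x then f h.choose else
      if h : ∃ w, G.Adj x (φ w) then f h.choose else ⟨0, hp⟩
    have hF : ∀ w, F (φ w) = f w := by
      intro w
      have h : ∃ w', φ w' = φ w := ⟨w, rfl⟩
      simp only [F, dif_pos h]
      rw [hφ.injective h.choose_spec]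
    have hF' : ∀ x w, x ∉ Set.range φ → G.Adj x (φ w) → c (F x) = c (f w) := by
      intro x w hx hxw
      have h : ∃ w, G.Adj x (φ w) := ⟨w, hxw⟩
      have hx' : ¬ ∃ w, φ w = x := hx
      simp only [F, dif_neg hx', dif_pos h]
      -- The dropped vertex `x` is a common neighbour of the two kept vertices, so some kept `v` is
      -- too, and the labels agree through `v`.
      obtain ⟨_, ⟨v, rfl⟩, hv₁, hv₂⟩ := hφ.common _ _ _ (hout _ _ h.choose_spec hx).1
        (hout _ _ hxw hx).1 h.choose_spec.symm hxw.symm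
      exact (h₁ _ _ hv₁).trans (h₁ _ _ hv₂).symm
    refine ⟨F, c, ?_, ?_, ?_⟩
    · intro a
      obtain ⟨w, hw⟩ := hs a
      exact ⟨φ w, (hF w).trans hw⟩
    · intro x y hxy
      by_cases hx : x ∈ Set.range φ
      · by_cases hy : y ∈ Set.range φ
        · obtain ⟨⟨v, rfl⟩, ⟨w, rfl⟩⟩ := And.intro hx hy
          rw [hF, hF]
          exact h₁ _ _ hxy
        · obtain ⟨v, rfl⟩ := hx
          rw [hF, hF' y v hy hxy.symm]
      · obtain ⟨w, rfl⟩ := (hout _ _ hxy hx).2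
        rw [hF, hF' x w hx hxy]
    · intro a b hab h
      obtain ⟨x, y, hx, hy, hxy⟩ := h₂ a b hab h
      exact ⟨φ x, φ y, (hF x).trans hx, (hF y).trans hy, hxy⟩
  · rintro ⟨f, c, hs, h₁, h₂⟩
    set s : Finset (Fin p × Fin p) := Finset.univ.filter fun q => q.1 ≠ q.2 ∧ c q.1 = c q.2 with hsdef
    have hmem : ∀ q, q ∈ s ↔ q.1 ≠ q.2 ∧ c q.1 = c q.2 := by simp [hsdef]
    have hcard : s.card ≤ p ^ 2 := by
      have := Finset.card_le_univ s
      rw [Fintype.card_prod, Fintype.card_fin] at this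
      nlinarith
    obtain ⟨F, hF, hFs⟩ := hE.exists_recolouring c s (by omega) (fun q hq => ((hmem q).1 hq).2) f h₁
      (fun q hq => h₂ _ _ ((hmem q).1 hq).1 ((hmem q).1 hq).2)
    have key : ∀ a b, a ≠ b → c a = c b →
        ∃ x y, x ∈ Set.range φ ∧ y ∈ Set.range φ ∧ F x = a ∧ F y = b ∧ G.Adj x y := by
      intro a b hab h
      obtain ⟨x, y, hx, hy, hxy | hxy⟩ := hFs (a, b) ((hmem _).2 ⟨hab, h⟩)
      · exact ⟨x, y, hφ.mem_range _ (pairDegree_pos_left hxy),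
          hφ.mem_range _ (pairDegree_pos_right hxy), hx, hy, hφ.adj _ hxy⟩
      · exact ⟨x, y, hφ.mem_range _ (pairDegree_pos_right hxy),
          hφ.mem_range _ (pairDegree_pos_left hxy), hx, hy, (hφ.adj _ hxy).symm⟩
    refine hasColouring_comap (f := F) ?_ (fun x y h => by rw [hF, hF, h₁ x y h]) key
    intro a
    by_cases ha : ∃ b, a ≠ b ∧ c a = c b
    · obtain ⟨b, hab, hc⟩ := ha
      obtain ⟨_, _, ⟨x, rfl⟩, -, hx, -⟩ := key a b hab hc
      exact ⟨x, hx⟩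
    -- No other colour has the label of `a`, so any kept vertex with this label already has colour
    -- `a`.
    · have hun : ∀ x, c (F x) = c a → F x = a := fun x hx =>
        by_contra fun h => ha ⟨F x, fun h' => h h'.symm, hx.symm⟩
      obtain ⟨x, hx⟩ := hs a
      rcases hL with hL | ⟨hL, ⟨w⟩⟩
      · by_cases hxr : x ∈ Set.range φ
        · obtain ⟨w, rfl⟩ := hxr
          exact ⟨w, hun _ (by rw [hF, hx])⟩
        · have hni : ∃ y, G.Adj x y := by
            by_contra! h
            exact hxr (hL x h)
          obtain ⟨y, hxy⟩ := hni
          obtain ⟨w, rfl⟩ := (hout _ _ hxy hxr).2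
          exact ⟨w, hun _ (by rw [hF, ← h₁ _ _ hxy, hx])⟩
      · exact ⟨w, hun _ (Subsingleton.elim _ _)⟩

end Kernel

/-! ### The kernelization rule, its correctness and its size. -/

lemma sum_pairDegree_le {V : Type} [Fintype V] [DecidableEq V] (E : Finset (V × V)) :
    ∑ x, pairDegree E x ≤ 2 * E.card := by
  have h₁ : E.card = ∑ x, (E.filter fun e => e.1 = x).card :=
    Finset.card_eq_sum_card_fiberwise fun _ _ => Finset.mem_univ _
  have h₂ : E.card = ∑ x, (E.filter fun e => e.2 = x).card :=
    Finset.card_eq_sum_card_fiberwise fun _ _ => Finset.mem_univ _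
  calc ∑ x, pairDegree E x
      ≤ ∑ x, ((E.filter fun e => e.1 = x).card + (E.filter fun e => e.2 = x).card) :=
        Finset.sum_le_sum fun x _ => by
          rw [pairDegree, Finset.filter_or]
          exact Finset.card_union_le _ _
    _ = 2 * E.card := by rw [Finset.sum_add_distrib, ← h₁, ← h₂, two_mul]

/-- The degree bound of the kernelization. -/
def degreeBound (p : ℕ) : ℕ := 4 * p ^ 2 + 1

open scoped Classical in
/-- The number of isolated vertices before `v`. -/
noncomputable def isolatedBefore {n : ℕ} (G : SimpleGraph (Fin n)) (v : ℕ) : ℕ :=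
  (Finset.univ.filter fun u : Fin n => u.1 < v ∧ ∀ y, ¬ G.Adj u y).card

/-- The vertices that the kernelization keeps: the first `p` vertices, the vertices of positive
degree, the chosen common neighbours and the first `p` isolated vertices. -/
def IsKept {n : ℕ} (G : SimpleGraph (Fin n)) (p : ℕ) (E : Finset (Fin n × Fin n))
    (w : Fin n → Fin n → ℕ) (v : Fin n) : Prop :=
  v.1 < p ∨ 0 < pairDegree E v ∨ (∃ x y, w x y = v.1) ∨
    (∀ y, ¬ G.Adj v y) ∧ isolatedBefore G v.1 < p

/-- `E` is a maximal set of edges among those with bounded degree and size. -/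
structure IsGreedyEdgeSet {n : ℕ} (G : SimpleGraph (Fin n)) (p : ℕ) (E : Finset (Fin n × Fin n)) :
    Prop where
  adj : ∀ e ∈ E, G.Adj e.1 e.2
  degree_le : ∀ x, pairDegree E x ≤ degreeBound p
  card_le : E.card ≤ degreeBound p ^ 2
  maximal : ∀ x y, G.Adj x y → (x, y) ∈ E ∨ (y, x) ∈ E ∨ degreeBound p ≤ pairDegree E x ∨
    degreeBound p ≤ pairDegree E y ∨ degreeBound p ^ 2 ≤ E.card

/-- `w` chooses a common neighbour of any two vertices of large degree that have one. The values
that are not less than `n` stand for the absence of one. -/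
structure IsNeighbourChoice {n : ℕ} (G : SimpleGraph (Fin n)) (p : ℕ) (E : Finset (Fin n × Fin n))
    (w : Fin n → Fin n → ℕ) : Prop where
  common : ∀ x y v, degreeBound p ≤ pairDegree E x → degreeBound p ≤ pairDegree E y →
    G.Adj x v → G.Adj y v → ∃ z : Fin n, w x y = z.1 ∧ G.Adj x z ∧ G.Adj y z
  degree : ∀ x y, w x y < n → degreeBound p ≤ pairDegree E x ∧ degreeBound p ≤ pairDegree E y

/-- `J` is a possible result of the kernelization of `I`. -/
def IsKernelization (I J : Instance) : Prop :=
  ∃ (E : Finset (Fin I.n × Fin I.n)) (w : Fin I.n → Fin I.n → ℕ) (φ : Fin J.n → Fin I.n),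
    IsGreedyEdgeSet I.G I.dualParam E ∧ IsNeighbourChoice I.G I.dualParam E w ∧
    Function.Injective φ ∧ (∀ v, v ∈ Set.range φ ↔ IsKept I.G I.dualParam E w v) ∧
    J.G = I.G.comap φ ∧ J.k = J.n - I.dualParam

lemma isolatedBefore_lt {n : ℕ} {G : SimpleGraph (Fin n)} {u v : Fin n} (huv : u < v)
    (hu : ∀ y, ¬ G.Adj u y) : isolatedBefore G u < isolatedBefore G v := by
  classical
  refine Finset.card_lt_card ((Finset.ssubset_iff_of_subset ?_).2 ⟨u, ?_, ?_⟩)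
  · exact Finset.monotone_filter_right _ fun x _ hx => ⟨hx.1.trans huv, hx.2⟩
  · simp [huv, hu]
  · simp

lemma card_isolated_kept_le {n : ℕ} (G : SimpleGraph (Fin n)) (p : ℕ) (S : Finset (Fin n))
    (hS : ∀ v ∈ S, (∀ y, ¬ G.Adj v y) ∧ isolatedBefore G v.1 < p) : S.card ≤ p := by
  rw [← Finset.card_range p]
  refine Finset.card_le_card_of_injOn (fun v => isolatedBefore G v.1)
    (fun v hv => Finset.mem_coe.2 (Finset.mem_range.2 (hS v hv).2)) ?_
  intro u hu v hv huv
  rcases lt_trichotomy u v with h | h | h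
  · exact absurd huv (isolatedBefore_lt h (hS u hu).1).ne
  · exact h
  · exact absurd huv (isolatedBefore_lt h (hS v hv).1).ne'

/-- If some isolated vertex is dropped, then at least `p` isolated vertices are kept. -/
lemma exists_isolated_kept {n : ℕ} (G : SimpleGraph (Fin n)) (p : ℕ) (P : Fin n → Prop)
    (hP : ∀ v, (∀ y, ¬ G.Adj v y) ∧ isolatedBefore G v.1 < p → P v) {x : Fin n}
    (hx : ∀ y, ¬ G.Adj x y) (hPx : ¬ P x) :
    ∃ i : Fin p → Fin n, Function.Injective i ∧ ∀ a, (∀ y, ¬ G.Adj (i a) y) ∧ P (i a) := by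
  classical
  -- Take the first dropped isolated vertex: all isolated vertices before it are kept, and there are
  -- at least `p` of them, for otherwise it would be kept too.
  have hex : ∃ m, ∃ h : m < n, (∀ y, ¬ G.Adj ⟨m, h⟩ y) ∧ ¬ P ⟨m, h⟩ := ⟨x.1, x.2, hx, hPx⟩
  obtain ⟨hm, hm₁, hm₂⟩ := Nat.find_spec hex
  set m := Nat.find hex
  set S := Finset.univ.filter fun u : Fin n => u.1 < m ∧ ∀ y, ¬ G.Adj u y with hS
  have hcard : p ≤ S.card := by
    by_contra! h
    exact hm₂ (hP _ ⟨hm₁, h⟩)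
  obtain ⟨T, hTS, hT⟩ := Finset.exists_subset_card_eq hcard
  refine ⟨fun a => T.orderEmbOfFin hT a, (T.orderEmbOfFin hT).injective, fun a => ?_⟩
  have ha := hTS (T.orderEmbOfFin_mem hT a)
  simp only [hS, Finset.mem_filter, Finset.mem_univ, true_and] at ha
  refine ⟨ha.2, by_contra fun h => ?_⟩
  exact Nat.find_min hex ha.1 ⟨(T.orderEmbOfFin hT a).2, ha.2, h⟩

lemma IsKernelization.isKernelMap {I : Instance} {n' : ℕ} {E : Finset (Fin I.n × Fin I.n)}
    {w : Fin I.n → Fin I.n → ℕ} {φ : Fin n' → Fin I.n}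
    (hE : IsGreedyEdgeSet I.G I.dualParam E) (hw : IsNeighbourChoice I.G I.dualParam E w)
    (hφ : Function.Injective φ) (hr : ∀ v, v ∈ Set.range φ ↔ IsKept I.G I.dualParam E w v) :
    IsKernelMap I.G (degreeBound I.dualParam) E φ where
  injective := hφ
  adj := hE.adj
  mem_range x hx := (hr x).2 (Or.inr (Or.inl hx))
  common x y v hx hy hxv hyv := by
    obtain ⟨z, hz, hxz, hyz⟩ := hw.common x y v hx hy hxv hyv
    exact ⟨z, (hr z).2 (Or.inr (Or.inr (Or.inl ⟨x, y, hz⟩))), hxz, hyz⟩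

/-- This is why the first `p` vertices are kept: they force `p ≤ J.n`, so the truncated subtraction
`J.k = J.n - p` loses nothing. -/
lemma IsKernelization.dualParam_eq {I J : Instance} (h : IsKernelization I J) :
    J.dualParam = I.dualParam := by
  obtain ⟨E, w, φ, hE, hw, hφ, hr, hG, hk⟩ := h
  have hle : I.dualParam ≤ J.n := by
    have hn : I.dualParam ≤ I.n := Nat.sub_le _ _
    have : Function.Injective fun a : Fin I.dualParam =>
        ((hr (Fin.castLE hn a)).2 (Or.inl a.2)).choose := by
      intro a b hab
      have ha := ((hr (Fin.castLE hn a)).2 (Or.inl a.2)).choose_spec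
      have hb := ((hr (Fin.castLE hn b)).2 (Or.inl b.2)).choose_spec
      exact Fin.castLE_injective hn (ha.symm.trans ((congrArg φ hab).trans hb))
    simpa using Fintype.card_le_of_injective _ this
  unfold Instance.dualParam at hle hk ⊢
  omega

lemma IsKernelization.hasColouring_iff {I J : Instance} (h : IsKernelization I J)
    (hp : 0 < I.dualParam) {L : Type} (hL : L = ℕ ∨ L = Unit) :
    HasColouring L J.G I.dualParam ↔ HasColouring L I.G I.dualParam := by
  have hJ := h.dualParam_eq
  obtain ⟨E, w, φ, hE, hw, hφ, hr, hG, hk⟩ := h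
  have hmap := IsKernelization.isKernelMap hE hw hφ hr
  have hLn : Nonempty L := by
    rcases hL with rfl | rfl <;> infer_instance
  have hD : 4 * I.dualParam ^ 2 < degreeBound I.dualParam := Nat.lt_succ_self _
  rw [hG]
  by_cases hd : degreeBound I.dualParam ^ 2 ≤ E.card
  -- With `E` of full size both graphs are colourable; the original graph is treated as its own
  -- kernel.
  · have hid : IsKernelMap I.G (degreeBound I.dualParam) E id :=
      ⟨Function.injective_id, hE.adj, fun x _ => ⟨x, rfl⟩,
        fun x y v _ _ hx hy => ⟨v, ⟨v, rfl⟩, hx, hy⟩⟩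
    exact iff_of_true (hmap.hasColouring_of_card_le hp hE.degree_le hD hd)
      (by simpa using hid.hasColouring_of_card_le (L := L) hp hE.degree_le hD hd)
  have hsat : IsSaturated I.G (degreeBound I.dualParam) E := by
    refine ⟨hE.adj, fun x y hxy => ?_⟩
    have := hE.maximal x y hxy
    tauto
  rcases hL with rfl | rfl
  · by_cases hiso : ∀ x, (∀ y, ¬ I.G.Adj x y) → x ∈ Set.range φ
    · exact hmap.hasColouring_iff hp hD hsat (Or.inl hiso)
    · push Not at hiso
      obtain ⟨x, hx, hxr⟩ := hiso
      obtain ⟨i, hi, h⟩ := exists_isolated_kept I.G I.dualParam (· ∈ Set.range φ)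
        (fun v hv => (hr v).2 (Or.inr (Or.inr (Or.inr hv)))) hx hxr
      choose h₁ j hj using h
      refine iff_of_true (hasColouring_of_isolated hp j ?_ ?_) (hasColouring_of_isolated hp i hi h₁)
      · intro a b hab
        exact hi (by rw [← hj a, ← hj b, hab])
      · intro a y hy
        rw [SimpleGraph.comap_adj, hj] at hy
        exact h₁ _ _ hy
  · refine hmap.hasColouring_iff hp hD hsat (Or.inr ⟨inferInstance, ⟨⟨0, ?_⟩⟩⟩)
    unfold Instance.dualParam at hJ hp
    omega

lemma IsKernelization.mem_iff {I J : Instance} (h : IsKernelization I J) :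
    (J ∈ CliqueIdentification ↔ I ∈ CliqueIdentification) ∧
      (J ∈ ClusterIdentification ↔ I ∈ ClusterIdentification) := by
  simp only [mem_cliqueIdentification_iff, mem_clusterIdentification_iff, exists_hasColouring_iff,
    h.dualParam_eq]
  rcases Nat.eq_zero_or_pos I.dualParam with h₀ | h₀
  · simp [h₀]
  · exact ⟨or_congr_right (h.hasColouring_iff h₀ (Or.inr rfl)),
      or_congr_right (h.hasColouring_iff h₀ (Or.inl rfl))⟩

lemma IsKernelization.n_le {I J : Instance} (h : IsKernelization I J) :
    J.n ≤ 152 * max 1 I.dualParam ^ 4 := by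
  classical
  obtain ⟨E, w, φ, hE, hw, hφ, hr, hG, hk⟩ := h
  set p := I.dualParam
  set D := degreeBound p with hD
  have hsum : ∑ x, pairDegree E x ≤ 2 * D ^ 2 :=
    (sum_pairDegree_le E).trans (Nat.mul_le_mul_left _ hE.card_le)
  set A₁ := Finset.univ.filter fun v : Fin I.n => v.1 < p with hA₁
  set A₂ := Finset.univ.filter fun v : Fin I.n => 0 < pairDegree E v with hA₂
  set A₃ := Finset.univ.filter fun v : Fin I.n => ∃ x y, w x y = v.1 with hA₃
  set A₄ := Finset.univ.filter fun v : Fin I.n =>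
    (∀ y, ¬ I.G.Adj v y) ∧ isolatedBefore I.G v.1 < p with hA₄
  set S := Finset.univ.filter fun v : Fin I.n => D ≤ pairDegree E v with hS
  have hn : J.n ≤ (A₁ ∪ (A₂ ∪ (A₃ ∪ A₄))).card := by
    rw [← Fintype.card_fin J.n, ← Finset.card_univ, ← Finset.card_image_of_injective _ hφ]
    refine Finset.card_le_card fun v hv => ?_
    have := (hr v).1 (by simpa using hv)
    simpa [hA₁, hA₂, hA₃, hA₄, IsKept] using this
  have h₁ : A₁.card ≤ p := by
    rw [← Finset.card_range p]
    exact Finset.card_le_card_of_injOn Fin.val (fun v hv => by simpa [hA₁] using hv)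
      Fin.val_injective.injOn
  have h₂ : A₂.card ≤ 2 * D ^ 2 := by
    refine le_trans ?_ hsum
    rw [Finset.card_eq_sum_ones]
    exact (Finset.sum_le_sum fun v hv => (Finset.mem_filter.1 hv).2).trans
      (Finset.sum_le_sum_of_subset (Finset.subset_univ _))
  have hSc : S.card ≤ 2 * D := by
    have : S.card * D ≤ 2 * D ^ 2 := by
      refine le_trans ?_ hsum
      rw [← smul_eq_mul]
      exact (Finset.card_nsmul_le_sum _ _ _ fun v hv => (Finset.mem_filter.1 hv).2).trans
        (Finset.sum_le_sum_of_subset (Finset.subset_univ _))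
    have hD₀ : 0 < D := Nat.succ_pos _
    nlinarith
  have h₃ : A₃.card ≤ (2 * D) ^ 2 := by
    -- Values of `w` below `n` come only from pairs of vertices in `S`; the absence value is not a
    -- vertex and costs nothing.
    have : A₃.map Fin.valEmbedding ⊆ (S ×ˢ S).image fun q => w q.1 q.2 := by
      intro a ha
      obtain ⟨v, hv, rfl⟩ := Finset.mem_map.1 ha
      obtain ⟨x, y, hxy⟩ := (Finset.mem_filter.1 hv).2
      have := hw.degree x y (hxy ▸ v.2)
      exact Finset.mem_image.2 ⟨(x, y), by simpa [hS] using this, hxy⟩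
    have := (Finset.card_le_card this).trans Finset.card_image_le
    rw [Finset.card_map, Finset.card_product] at this
    nlinarith
  have h₄ : A₄.card ≤ p := card_isolated_kept_le I.G p A₄ fun v hv => (Finset.mem_filter.1 hv).2
  have h₅ := Finset.card_union_le A₁ (A₂ ∪ (A₃ ∪ A₄))
  have h₆ := Finset.card_union_le A₂ (A₃ ∪ A₄)
  have h₇ := Finset.card_union_le A₃ A₄
  set q := max 1 p
  have hq : 1 ≤ q := le_max_left _ _
  have hpq : p ≤ q := le_max_right _ _
  have hq₂ : 1 ≤ q ^ 2 := Nat.one_le_pow _ _ hq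
  have hDq : D ≤ 5 * q ^ 2 := by
    have : p ^ 2 ≤ q ^ 2 := Nat.pow_le_pow_left hpq 2
    rw [hD, degreeBound]
    omega
  have hD₂ : D ^ 2 ≤ 25 * q ^ 4 := by
    calc D ^ 2 ≤ (5 * q ^ 2) ^ 2 := Nat.pow_le_pow_left hDq 2
      _ = 25 * q ^ 4 := by ring
  -- The total is `2D² + 4D² + 2p ≤ 6 * 25 * q ^ 4 + 2 * q ^ 4`, whence the constant `152`.
  have hq₄ : q ≤ q ^ 4 := Nat.le_self_pow (by norm_num) q
  have : (2 * D) ^ 2 = 4 * D ^ 2 := by ring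
  omega


/-! ### A program logic with time bounds. -/

/-- A bound for the running time of a program in which every loop makes at most `X` rounds. -/
noncomputable def Prog.timeBound : Prog → Polynomial ℕ
  | .skip => 1
  | .assign _ e => Polynomial.C (e.cost + 1)
  | .store _ i e => Polynomial.C (i.cost + e.cost + 1)
  | .seq P Q => P.timeBound + Q.timeBound
  | .cond e P Q => Polynomial.C (e.cost + 1) + (P.timeBound + Q.timeBound)
  | .loop e P => (Polynomial.X + 1) * (Polynomial.C (e.cost + 1) + P.timeBound)

/-- The program does not write to register `x`. -/
def Prog.keepsReg (x : ℕ) : Prog → Bool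
  | .skip => true
  | .assign y _ => x != y
  | .store _ _ _ => true
  | .seq P Q => P.keepsReg x && Q.keepsReg x
  | .cond _ P Q => P.keepsReg x && Q.keepsReg x
  | .loop _ P => P.keepsReg x

/-- The program does not write to array `a`. -/
def Prog.keepsArr (a : ℕ) : Prog → Bool
  | .skip => true
  | .assign _ _ => true
  | .store b _ _ => a != b
  | .seq P Q => P.keepsArr a && Q.keepsArr a
  | .cond _ P Q => P.keepsArr a && Q.keepsArr a
  | .loop _ P => P.keepsArr a

/-- The registers and arrays to which `P` does not write have the same contents in `s` and `s'`. -/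
structure Frame (P : Prog) (s s' : Memory) : Prop where
  reg : ∀ x, P.keepsReg x = true → s'.reg x = s.reg x
  arr : ∀ a, P.keepsArr a = true → s'.arr a = s.arr a

lemma Frame.rfl {P : Prog} {s : Memory} : Frame P s s := ⟨fun _ _ => Eq.refl _, fun _ _ => Eq.refl _⟩

lemma Frame.trans {P : Prog} {s s' s'' : Memory} (h : Frame P s s') (h' : Frame P s' s'') :
    Frame P s s'' :=
  ⟨fun x hx => (h'.reg x hx).trans (h.reg x hx), fun a ha => (h'.arr a ha).trans (h.arr a ha)⟩

lemma Frame.mono {P Q : Prog} {s s' : Memory} (h : Frame P s s')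
    (hr : ∀ x, Q.keepsReg x = true → P.keepsReg x = true)
    (ha : ∀ a, Q.keepsArr a = true → P.keepsArr a = true) : Frame Q s s' :=
  ⟨fun x hx => h.reg x (hr x hx), fun a h' => h.arr a (ha a h')⟩

lemma Exec.frame {P : Prog} {s s' : Memory} {t : ℕ} (h : Exec P s s' t) : Frame P s s' := by
  induction h with
  | skip s => exact .rfl
  | assign x e s =>
    refine ⟨fun y hy => ?_, fun _ _ => rfl⟩
    have : y ≠ x := by simpa [Prog.keepsReg] using hy
    simp [this]
  | store a i e s =>
    refine ⟨fun _ _ => rfl, fun b hb => ?_⟩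
    have : b ≠ a := by simpa [Prog.keepsArr] using hb
    simp [this]
  | seq _ _ h₁ h₂ =>
    exact (h₁.mono (by simp +contextual [Prog.keepsReg]) (by simp +contextual [Prog.keepsArr])).trans
      (h₂.mono (by simp +contextual [Prog.keepsReg]) (by simp +contextual [Prog.keepsArr]))
  | condTrue _ _ h =>
    exact h.mono (by simp +contextual [Prog.keepsReg]) (by simp +contextual [Prog.keepsArr])
  | condFalse _ _ h =>
    exact h.mono (by simp +contextual [Prog.keepsReg]) (by simp +contextual [Prog.keepsArr])
  | loopTrue _ _ _ h₁ h₂ => exact Frame.trans (P := .loop _ _) (h₁.mono (fun _ h => h) (fun _ h => h)) h₂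
  | loopFalse _ => exact .rfl

/-- Started in `s`, the program halts in a state that satisfies `Q`, within the time bound for at
most `N` rounds per loop. -/
def Ends (N : ℕ) (P : Prog) (s : Memory) (Q : Memory → Prop) : Prop :=
  ∃ s' t, Exec P s s' t ∧ t ≤ P.timeBound.eval N ∧ Q s'

section Rules

variable {N : ℕ} {P P' : Prog} {s : Memory} {Q R : Memory → Prop}

lemma Ends.frame (h : Ends N P s Q) : Ends N P s fun s' => Frame P s s' ∧ Q s' := by
  obtain ⟨s', t, he, ht, hQ⟩ := h
  exact ⟨s', t, he, ht, he.frame, hQ⟩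

lemma Ends.imp (h : Ends N P s Q) (hQ : ∀ s', Q s' → R s') : Ends N P s R := by
  obtain ⟨s', t, he, ht, h⟩ := h
  exact ⟨s', t, he, ht, hQ _ h⟩

lemma Ends.skip (h : Q s) : Ends N .skip s Q := ⟨s, 1, .skip s, by simp [Prog.timeBound], h⟩

lemma Ends.assign {x : ℕ} {e : Expr} (h : Q ⟨Function.update s.reg x (e.val s), s.arr⟩) :
    Ends N (.assign x e) s Q := ⟨_, _, .assign x e s, by simp [Prog.timeBound], h⟩

lemma Ends.store {a : ℕ} {i e : Expr} (h : Q ⟨s.reg, Function.update s.arr a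
      (Function.update (s.arr a) (i.val s) (e.val s))⟩) :
    Ends N (.store a i e) s Q := ⟨_, _, .store a i e s, by simp [Prog.timeBound], h⟩

lemma Ends.seq (h : Ends N P s fun s' => Ends N P' s' Q) : Ends N (.seq P P') s Q := by
  obtain ⟨s', t, he, ht, s'', t', he', ht', hQ⟩ := h
  refine ⟨s'', _, .seq he he', ?_, hQ⟩
  simp only [Prog.timeBound, Polynomial.eval_add]
  omega

lemma Ends.cond {e : Expr} (h₁ : e.val s ≠ 0 → Ends N P s Q) (h₂ : e.val s = 0 → Ends N P' s Q) :
    Ends N (.cond e P P') s Q := by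
  by_cases h : e.val s = 0
  · obtain ⟨s', t, he, ht, hQ⟩ := h₂ h
    refine ⟨s', _, .condFalse h he, ?_, hQ⟩
    simp only [Prog.timeBound, Polynomial.eval_add, Polynomial.eval_C]
    omega
  · obtain ⟨s', t, he, ht, hQ⟩ := h₁ h
    refine ⟨s', _, .condTrue h he, ?_, hQ⟩
    simp only [Prog.timeBound, Polynomial.eval_add, Polynomial.eval_C]
    omega

/-- The invariant is indexed by the number of completed rounds, and exactly `r` rounds are made; the
factor `N + 1` in the time bound includes the final failing test. -/
lemma Ends.loop {e : Expr} {r : ℕ} (hr : r ≤ N) (I : ℕ → Memory → Prop) (h₀ : I 0 s)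
    (hstep : ∀ i s', i < r → I i s' → e.val s' ≠ 0 ∧ Ends N P s' (I (i + 1)))
    (hend : ∀ s', I r s' → e.val s' = 0 ∧ Q s') : Ends N (.loop e P) s Q := by
  suffices H : ∀ j i s, i + j = r → I i s → ∃ s' t, Exec (.loop e P) s s' t ∧
      t ≤ (j + 1) * (e.cost + 1 + P.timeBound.eval N) ∧ Q s' by
    obtain ⟨s', t, he, ht, hQ⟩ := H r 0 s (by omega) h₀
    refine ⟨s', t, he, ht.trans ?_, hQ⟩
    simp only [Prog.timeBound, Polynomial.eval_mul, Polynomial.eval_add, Polynomial.eval_C,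
      Polynomial.eval_X, Polynomial.eval_one]
    gcongr
  intro j
  induction j with
  | zero =>
    rintro i s hi h
    obtain rfl : i = r := by omega
    obtain ⟨h₁, h₂⟩ := hend s h
    exact ⟨s, _, .loopFalse h₁, by omega, h₂⟩
  | succ j ih =>
    rintro i s hi h
    obtain ⟨h₁, s', t, he, ht, h₂⟩ := hstep i s (by omega) h
    obtain ⟨s'', t', he', ht', hQ⟩ := ih (i + 1) s' (by omega) h₂
    refine ⟨s'', _, .loopTrue h₁ he he', ?_, hQ⟩
    rw [add_mul (j + 1)]
    omega

/-- `for x < b do P`. -/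
def Prog.for (x b : ℕ) (P : Prog) : Prog :=
  .seq (.assign x (.const 0)) (.loop (.sub (.reg b) (.reg x))
    (.seq P (.assign x (.add (.reg x) (.const 1)))))

/-- The invariant must not depend on the loop register, whose value is tracked separately. The side
conditions on written registers are Boolean computations. -/
lemma Ends.for {x b r : ℕ} (I : ℕ → Memory → Prop)
    (hx : ∀ i s a, I i s → I i ⟨Function.update s.reg x a, s.arr⟩)
    (hb : s.reg b = r) (hr : r ≤ N) (hxP : P.keepsReg x = true)
    (hbP : (Prog.for x b P).keepsReg b = true) (h₀ : I 0 s)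
    (hstep : ∀ i s', i < r → s'.reg x = i → Frame (.for x b P) s s' → I i s' →
      Ends N P s' (I (i + 1))) : Ends N (.for x b P) s (I r) := by
  refine .seq (.assign (.loop hr (fun i s' => s'.reg x = i ∧ Frame (.for x b P) s s' ∧ I i s')
    ⟨by simp [Expr.val], ?_, hx _ _ _ h₀⟩ ?_ ?_))
  · exact (Exec.assign x (.const 0) s).frame.mono
      (by simp +contextual [Prog.for, Prog.keepsReg]) (by simp +contextual [Prog.for, Prog.keepsArr])
  · rintro i s' hi ⟨h₁, h₂, h₃⟩
    refine ⟨?_, .seq ((hstep i s' hi h₁ h₂ h₃).frame.imp fun s'' h => .assign ⟨?_, ?_, hx _ _ _ h.2⟩)⟩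
    · have := (h₂.reg b hbP).trans hb
      simp only [Expr.val]
      omega
    · simp [Expr.val, h.1.reg x hxP, h₁]
    · refine h₂.trans ((h.1.mono ?_ ?_).trans
        ((Exec.assign x (.add (.reg x) (.const 1)) s'').frame.mono ?_ ?_)) <;>
      simp +contextual [Prog.for, Prog.keepsReg, Prog.keepsArr]
  · rintro s' ⟨h₁, h₂, h₃⟩
    have := (h₂.reg b hbP).trans hb
    exact ⟨by simp only [Expr.val]; omega, h₃⟩

/-- Two nested loops with the same number of rounds. -/
lemma Ends.forTwo {x y b r : ℕ} (I : ℕ → ℕ → Memory → Prop)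
    (hx : ∀ i j s a, I i j s → I i j ⟨Function.update s.reg x a, s.arr⟩)
    (hy : ∀ i j s a, I i j s → I i j ⟨Function.update s.reg y a, s.arr⟩)
    (hb : s.reg b = r) (hr : r ≤ N) (hxP : (Prog.for y b P).keepsReg x = true)
    (hyP : P.keepsReg y = true)
    (hbP : (Prog.for x b (.for y b P)).keepsReg b = true) (h₀ : I 0 0 s)
    (hrow : ∀ i s', I i r s' → I (i + 1) 0 s')
    (hstep : ∀ i j s', i < r → j < r → s'.reg x = i → s'.reg y = j →
      Frame (.for x b (.for y b P)) s s' → I i j s' → Ends N P s' (I i (j + 1))) :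
    Ends N (.for x b (.for y b P)) s (I r 0) := by
  have hbP' : (Prog.for y b P).keepsReg b = true := by
    simp only [Prog.for, Prog.keepsReg, Bool.and_eq_true] at hbP ⊢
    tauto
  refine .for (fun i => I i 0) (fun i => hx i 0) hb hr hxP hbP h₀ fun i s' hi h₁ h₂ h₃ => ?_
  refine Ends.imp (Ends.for (I i) (hy i) ((h₂.reg b hbP).trans hb) hr hyP hbP' h₃
    fun j s'' hj h₄ h₅ h₆ => ?_) (hrow i)
  refine hstep i j s'' hi hj ((h₅.reg x hxP).trans h₁) h₄ (h₂.trans (h₅.mono ?_ ?_)) h₆ <;>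
  simp +contextual [Prog.for, Prog.keepsReg, Prog.keepsArr]

end Rules

/-- The value of `e₁.and e₂` is nonzero if both values are. -/
def Expr.and (e₁ e₂ : Expr) : Expr :=
  .sub (.const 1) (.add (.sub (.const 1) e₁) (.sub (.const 1) e₂))

lemma Expr.and_val_ne_zero {e₁ e₂ : Expr} {s : Memory} :
    (e₁.and e₂).val s ≠ 0 ↔ e₁.val s ≠ 0 ∧ e₂.val s ≠ 0 := by
  simp only [Expr.and, Expr.val]
  omega


/-! ### The encoding of instances and the kernelization program. -/

open scoped Classical in
/-- The entry of the adjacency matrix. -/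
noncomputable def adjBit {V : Type} (G : SimpleGraph V) (x y : V) : ℕ := if G.Adj x y then 1 else 0

lemma adjBit_ne_zero {V : Type} {G : SimpleGraph V} {x y : V} : adjBit G x y ≠ 0 ↔ G.Adj x y := by
  simp [adjBit]

lemma Instance.length_encode (I : Instance) : I.encode.length = I.n * I.n + 2 := by
  simp [Instance.encode]

lemma Instance.encode_getD_adj (I : Instance) (x y : Fin I.n) :
    I.encode.getD (2 + x * I.n + y) 0 = adjBit I.G x y := by
  have hlt : x.1 * I.n + y.1 < I.n * I.n := by
    have := x.2
    have := y.2
    nlinarith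
  have h : finProdFinEquiv.symm (⟨x.1 * I.n + y.1, hlt⟩ : Fin (I.n * I.n)) = (x, y) := by
    rw [Equiv.symm_apply_eq]
    ext
    simp [finProdFinEquiv, mul_comm, add_comm]
  have h' : 2 + x.1 * I.n + y.1 = (x.1 * I.n + y.1) + 1 + 1 := by omega
  rw [h', Instance.encode, List.getD_cons_succ, List.getD_cons_succ,
    List.getD_eq_getElem _ _ (by simpa using hlt), List.getElem_ofFn]
  unfold adjBit
  rw [h]

lemma hasOutput_encode {J : Instance} {s : Memory} (hn : s.arr 1 0 = J.n) (hk : s.arr 1 1 = J.k)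
    (h : ∀ x y : Fin J.n, s.arr 1 (2 + x * J.n + y) = adjBit J.G x y) : HasOutput s J.encode := by
  intro i hi
  match i, hi with
  | 0, _ => exact hn
  | 1, _ => exact hk
  | i + 2, hi =>
    have hi' : i < J.n * J.n := by
      rw [Instance.length_encode] at hi
      omega
    have hJ : 0 < J.n := Nat.pos_of_ne_zero fun h => by simp [h] at hi'
    have hx : i / J.n < J.n := Nat.div_lt_of_lt_mul hi'
    have hy : i % J.n < J.n := Nat.mod_lt _ hJ
    have he : 2 + i / J.n * J.n + i % J.n = i + 2 := by
      rw [add_assoc, Nat.div_add_mod', add_comm]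
    have h₁ := h ⟨_, hx⟩ ⟨_, hy⟩
    have h₂ := J.encode_getD_adj ⟨_, hx⟩ ⟨_, hy⟩
    rw [← List.getD_eq_getElem _ 0 hi]
    simp only [he] at h₁ h₂
    rw [h₁, h₂]

/-- `x := y * y`, with loop variable `i`. -/
def Prog.square (i x y : ℕ) : Prog :=
  .seq (.assign x (.const 0)) (.for i y (.assign x (.add (.reg x) (.reg y))))

lemma Ends.square {N i x y : ℕ} {s : Memory} {Q : Memory → Prop} (hix : i ≠ x) (hiy : i ≠ y)
    (hxy : x ≠ y) (hN : s.reg y ≤ N)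
    (hQ : ∀ s', Frame (.square i x y) s s' → s'.reg x = s.reg y * s.reg y → Q s') :
    Ends N (.square i x y) s Q := by
  refine (Ends.frame (Q := fun s' => s'.reg x = s.reg y * s.reg y) ?_).imp
    fun s' h => hQ s' h.1 h.2
  refine .seq (.assign ?_)
  refine Ends.for (fun j s' => s'.reg x = j * s.reg y) ?_ ?_ hN ?_ ?_ ?_ ?_
  · intro j s' a h
    simpa [hix.symm] using h
  · simp [hxy.symm]
  · simpa [Prog.keepsReg] using hix
  · simp [Prog.for, Prog.keepsReg, hiy.symm, hxy.symm]
  · simp [Expr.val]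
  · intro j s' _ _ hf h
    have hy := hf.reg y (by simp [Prog.for, Prog.keepsReg, hiy.symm, hxy.symm])
    refine .assign ?_
    simp only [Function.update_of_ne hxy.symm] at hy
    simp only [Expr.val, Function.update_self, h, hy]
    ring

/-- The entry of the adjacency matrix for the vertices in registers `x` and `y`. -/
def Expr.adj (x y : ℕ) : Expr := .load 0 (.add (.load 2 (.reg x)) (.reg y))

/-- The parameters, the degree bound, its square, and the offsets of the rows of the adjacency
matrix are computed. -/
def setupProg : Prog :=
  .seq (.assign 0 (.load 0 (.const 0))) <|
  .seq (.assign 1 (.sub (.load 0 (.const 0)) (.load 0 (.const 1)))) <|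
  .seq (.square 4 2 1) <|
  .seq (.assign 2 (.add (.add (.add (.add (.reg 2) (.reg 2)) (.reg 2)) (.reg 2)) (.const 1))) <|
  .seq (.square 4 3 2) <|
  .seq (.assign 5 (.const 2)) <|
  .for 4 0 (.seq (.store 2 (.reg 4) (.reg 5)) (.assign 5 (.add (.reg 5) (.reg 0))))

/-- The edges of `E` are chosen greedily; array `3` holds the degrees. -/
def greedyProg : Prog :=
  .seq (.assign 6 (.const 0)) <|
  .for 4 0 <| .for 5 0 <|
    .cond (.and (.adj 4 5) (.and (.sub (.reg 5) (.reg 4)) (.and (.sub (.reg 3) (.reg 6))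
        (.and (.sub (.reg 2) (.load 3 (.reg 4))) (.sub (.reg 2) (.load 3 (.reg 5)))))))
      (.seq (.store 3 (.reg 4) (.add (.load 3 (.reg 4)) (.const 1))) <|
        .seq (.store 3 (.reg 5) (.add (.load 3 (.reg 5)) (.const 1)))
          (.assign 6 (.add (.reg 6) (.const 1))))
      .skip

/-- Array `4` gets the degrees in the input graph. -/
def degreeProg : Prog :=
  .for 4 0 <| .for 5 0 <| .store 4 (.reg 4) (.add (.load 4 (.reg 4)) (.adj 4 5))

/-- Common neighbours are chosen and marked in array `5`. -/
def neighbourProg : Prog :=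
  .for 4 0 <| .for 5 0 <|
    .seq (.assign 7 (.reg 0)) <|
    .seq (.for 8 0 <| .cond (.and (.and (.adj 4 8) (.adj 5 8))
        (.and (.sub (.add (.load 3 (.reg 4)) (.const 1)) (.reg 2))
          (.sub (.add (.load 3 (.reg 5)) (.const 1)) (.reg 2))))
        (.assign 7 (.reg 8)) .skip) <|
    .store 5 (.reg 7) (.const 1)

/-- The vertices of the kernel are listed in array `6`. -/
def collectProg : Prog :=
  .seq (.assign 9 (.const 0)) <| .seq (.assign 10 (.const 0)) <|
  .for 4 0 <|
    .seq (.cond (.add (.sub (.reg 1) (.reg 4)) (.add (.load 3 (.reg 4)) (.add (.load 5 (.reg 4))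
        (.and (.sub (.const 1) (.load 4 (.reg 4))) (.sub (.reg 1) (.reg 9))))))
      (.seq (.store 6 (.reg 10) (.reg 4)) (.assign 10 (.add (.reg 10) (.const 1)))) .skip)
    (.assign 9 (.add (.reg 9) (.sub (.const 1) (.load 4 (.reg 4)))))

/-- The kernel is written to array `1`. -/
def outputProg : Prog :=
  .seq (.store 1 (.const 0) (.reg 10)) <|
  .seq (.store 1 (.const 1) (.sub (.reg 10) (.reg 1))) <|
  .seq (.assign 11 (.const 2)) <|
  .for 4 10 <| .for 5 10 <|
    .seq (.store 1 (.reg 11) (.load 0 (.add (.load 2 (.load 6 (.reg 4))) (.load 6 (.reg 5)))))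
      (.assign 11 (.add (.reg 11) (.const 1)))

/-- The data that are computed first. -/
structure Ready (I : Instance) (s : Memory) : Prop where
  n : s.reg 0 = I.n
  p : s.reg 1 = I.dualParam
  bound : s.reg 2 = degreeBound I.dualParam
  bound_sq : s.reg 3 = degreeBound I.dualParam ^ 2
  adj : ∀ x y : Fin I.n, s.arr 0 (s.arr 2 x + y) = adjBit I.G x y

lemma Frame.ready {I : Instance} {P : Prog} {s s' : Memory} (hf : Frame P s s') (h : Ready I s)
    (hP : (P.keepsReg 0 && P.keepsReg 1 && P.keepsReg 2 && P.keepsReg 3 && P.keepsArr 0 &&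
      P.keepsArr 2) = true) : Ready I s' := by
  simp only [Bool.and_eq_true] at hP
  obtain ⟨⟨⟨⟨⟨h₀, h₁⟩, h₂⟩, h₃⟩, h₄⟩, h₅⟩ := hP
  exact ⟨(hf.reg 0 h₀).trans h.n, (hf.reg 1 h₁).trans h.p, (hf.reg 2 h₂).trans h.bound,
    (hf.reg 3 h₃).trans h.bound_sq, by rw [hf.arr 0 h₄, hf.arr 2 h₅]; exact h.adj⟩

lemma Ready.val_adj {I : Instance} {s : Memory} (h : Ready I s) {i j : ℕ} {x y : Fin I.n}
    (hx : s.reg i = x.1) (hy : s.reg j = y.1) : (Expr.adj i j).val s = adjBit I.G x y := by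
  simp only [Expr.adj, Expr.val, hx, hy]
  exact h.adj x y

/-- The machine cannot multiply: squares arise by repeated addition, and row offsets are tabulated
so that later adjacency queries cost a constant number of steps. -/
lemma setupProg_ends (I : Instance) {N : ℕ} (hn : I.n ≤ N) (hD : degreeBound I.dualParam ≤ N) :
    Ends N setupProg (initMemory I.encode) fun s => Ready I s ∧ s.arr 3 = 0 ∧ s.arr 4 = 0 ∧
      s.arr 5 = 0 := by
  have hp : I.dualParam ≤ N := (Nat.sub_le _ _).trans hn
  have h₀ : I.encode.getD 0 0 = I.n := rfl
  have h₁ : I.encode.getD 1 0 = I.k := rfl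
  refine (Ends.frame (Q := fun s => Ready I s) ?_).imp fun s hs =>
    ⟨hs.2, hs.1.arr 3 rfl, hs.1.arr 4 rfl, hs.1.arr 5 rfl⟩
  refine .seq (.assign (.seq (.assign (.seq (.square (by decide) (by decide) (by decide) ?_ ?_)))))
  · simpa [Expr.val, initMemory, Instance.dualParam, ← h₀, ← h₁] using hp
  intro s hs h₂
  have hsn : s.reg 0 = I.n := hs.reg 0 rfl
  have hsp : s.reg 1 = I.dualParam := hs.reg 1 rfl
  have hsa : s.arr 0 = fun i => I.encode.getD i 0 := hs.arr 0 rfl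
  replace h₂ : s.reg 2 = I.dualParam * I.dualParam := h₂
  have hD' : s.reg 2 + s.reg 2 + s.reg 2 + s.reg 2 + 1 = degreeBound I.dualParam := by
    rw [h₂, degreeBound]
    ring
  refine .seq (.assign (.seq (.square (by decide) (by decide) (by decide) ?_ ?_)))
  · simpa [Expr.val, hD'] using hD
  intro s' hs' h₃
  refine .seq (.assign ?_)
  refine Ends.imp (Ends.frame (Ends.for (fun i t => t.reg 5 = 2 + i * I.n ∧
    ∀ x : Fin I.n, x.1 < i → t.arr 2 x = 2 + x * I.n) (fun _ _ _ h => h) (r := I.n)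
      ((hs'.reg 0 rfl).trans hsn) hn rfl rfl ?_ ?_)) ?_
  · simp [Expr.val]
  · rintro i t hi ht hf ⟨h₅, h⟩
    have ht₀ : t.reg 0 = I.n := (hf.reg 0 rfl).trans ((hs'.reg 0 rfl).trans hsn)
    refine .seq (.store (.assign ⟨?_, ?_⟩))
    · simp [Expr.val, h₅, ht₀]
      ring
    · intro x hx
      by_cases hxi : x.1 = i
      · simp [Expr.val, ht, hxi, h₅]
      · simpa [Expr.val, ht, hxi] using h x (by omega)
  · rintro t ⟨hf, -, h⟩
    refine ⟨(hf.reg 0 rfl).trans ((hs'.reg 0 rfl).trans hsn),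
      (hf.reg 1 rfl).trans ((hs'.reg 1 rfl).trans hsp), ?_, ?_, ?_⟩
    · exact (hf.reg 2 rfl).trans ((hs'.reg 2 rfl).trans hD')
    · refine (hf.reg 3 rfl).trans (h₃.trans ?_)
      rw [sq, ← hD']
      rfl
    · intro x y
      have : t.arr 0 = fun i => I.encode.getD i 0 := (hf.arr 0 rfl).trans ((hs'.arr 0 rfl).trans hsa)
      rw [h x x.2, this]
      exact I.encode_getD_adj x y


/-! ### Correctness of the phases of the program. -/

/-- The pair `(x, y)` comes before `(i, j)` in the lexicographic order. -/
def Before {n : ℕ} (i j : ℕ) (x y : Fin n) : Prop := x.1 < i ∨ x.1 = i ∧ y.1 < j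

lemma not_before_zero {n : ℕ} (x y : Fin n) : ¬ Before 0 0 x y := by
  unfold Before
  omega

lemma before_row {n i : ℕ} (x y : Fin n) : Before i n x y ↔ Before (i + 1) 0 x y := by
  have := y.2
  unfold Before
  omega

lemma before_top {n : ℕ} (x y : Fin n) : Before n 0 x y := Or.inl x.2

lemma before_succ {n : ℕ} (u v x y : Fin n) :
    Before u.1 (v.1 + 1) x y ↔ Before u.1 v.1 x y ∨ x = u ∧ y = v := by
  simp only [Before, Fin.ext_iff]
  omega

lemma not_before_self {n : ℕ} (u v : Fin n) : ¬ Before u.1 v.1 u v := by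
  simp [Before]

lemma pairDegree_insert {V : Type} [DecidableEq V] {E : Finset (V × V)} {u v : V} (h : (u, v) ∉ E)
    (x : V) : pairDegree (insert (u, v) E) x = pairDegree E x + if u = x ∨ v = x then 1 else 0 := by
  unfold pairDegree
  rw [Finset.filter_insert]
  split_ifs with hx
  · rw [Finset.card_insert_of_notMem (by simp [h])]
  · rfl

/-- Degrees and the size of `E` only grow, so the reason for rejecting an edge persists to the end.
Only pairs with `x < y` are inserted, so each edge is counted once. -/
lemma greedyProg_ends {I : Instance} {N : ℕ} (hn : I.n ≤ N) {s : Memory} (hs : Ready I s)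
    (h₃ : s.arr 3 = 0) :
    Ends N greedyProg s fun s' => ∃ E, IsGreedyEdgeSet I.G I.dualParam E ∧
      ∀ x : Fin I.n, s'.arr 3 x = pairDegree E x := by
  set D := degreeBound I.dualParam with hD
  refine .seq (.assign (Ends.imp (Ends.forTwo (r := I.n) (fun i j t =>
    ∃ E : Finset (Fin I.n × Fin I.n), (∀ e ∈ E, I.G.Adj e.1 e.2 ∧ Before i j e.1 e.2) ∧
      (∀ x, pairDegree E x ≤ D) ∧ E.card ≤ D ^ 2 ∧
      (∀ x y, Before i j x y → I.G.Adj x y → x < y → (x, y) ∈ E ∨ D ≤ pairDegree E x ∨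
        D ≤ pairDegree E y ∨ D ^ 2 ≤ E.card) ∧
      t.reg 6 = E.card ∧ ∀ x : Fin I.n, t.arr 3 x = pairDegree E x)
    (fun _ _ _ _ h => h) (fun _ _ _ _ h => h) hs.n hn rfl rfl rfl ?_ ?_ ?_) ?_))
  · refine ⟨∅, by simp, by simp [pairDegree], by simp, ?_, by simp [Expr.val], ?_⟩
    · intro x y h
      exact absurd h (not_before_zero x y)
    · simp [pairDegree, h₃]
  · rintro i t ⟨E, h₁, h₂, h₃, h₄, h₅, h₆⟩
    simp only [before_row] at h₁ h₄
    exact ⟨E, h₁, h₂, h₃, h₄, h₅, h₆⟩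
  · rintro i j t hi hj hti htj hf ⟨E, h₁, h₂, h₃, h₄, h₅, h₆⟩
    obtain ⟨u, rfl⟩ : ∃ u : Fin I.n, u.1 = i := ⟨⟨i, hi⟩, rfl⟩
    obtain ⟨v, rfl⟩ : ∃ v : Fin I.n, v.1 = j := ⟨⟨j, hj⟩, rfl⟩
    have hR : Ready I t := hf.ready ⟨hs.n, hs.p, hs.bound, hs.bound_sq, hs.adj⟩ rfl
    have huv : (u, v) ∉ E := fun h => not_before_self u v (h₁ _ h).2
    -- A truncated difference is nonzero exactly when the comparison `<` is strict, so subtraction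
    -- serves as the test.
    have hcond : (Expr.and (.adj 4 5) (.and (.sub (.reg 5) (.reg 4)) (.and (.sub (.reg 3) (.reg 6))
        (.and (.sub (.reg 2) (.load 3 (.reg 4))) (.sub (.reg 2) (.load 3 (.reg 5))))))).val t ≠ 0 ↔
        I.G.Adj u v ∧ u < v ∧ E.card < D ^ 2 ∧ pairDegree E u < D ∧ pairDegree E v < D := by
      simp only [Expr.and_val_ne_zero, hR.val_adj hti htj, adjBit_ne_zero]
      simp only [Expr.val, hti, htj, hR.bound, hR.bound_sq, h₅, h₆, Fin.lt_def, Nat.sub_ne_zero_iff_lt]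
      rfl
    refine .cond (fun h => ?_) (fun h => ?_)
    · obtain ⟨ha, hlt, hc, hu, hv⟩ := hcond.1 h
      refine .seq (.store (.seq (.store (.assign ⟨insert (u, v) E, ?_, ?_, ?_, ?_, ?_, ?_⟩))))
      · intro e he
        rw [before_succ]
        rcases Finset.mem_insert.1 he with rfl | he
        · exact ⟨ha, Or.inr ⟨rfl, rfl⟩⟩
        · exact ⟨(h₁ e he).1, Or.inl (h₁ e he).2⟩
      · intro x
        rw [pairDegree_insert huv]
        split_ifs with hx
        · rcases hx with rfl | rfl
          · exact hu
          · exact hv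
        · exact h₂ x
      · rw [Finset.card_insert_of_notMem huv]
        exact hc
      · intro x y hb hxy hlt
        rw [before_succ] at hb
        rcases hb with hb | ⟨rfl, rfl⟩
        · have hx := pairDegree_mono (Finset.subset_insert (u, v) E) x
          have hy := pairDegree_mono (Finset.subset_insert (u, v) E) y
          have hE := Finset.card_le_card (Finset.subset_insert (u, v) E)
          rcases h₄ x y hb hxy hlt with h | h | h | h
          · exact Or.inl (Finset.mem_insert_of_mem h)
          · exact Or.inr (Or.inl (h.trans hx))
          · exact Or.inr (Or.inr (Or.inl (h.trans hy)))
          · exact Or.inr (Or.inr (Or.inr (h.trans hE)))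
        · exact Or.inl (Finset.mem_insert_self _ _)
      · rw [Finset.card_insert_of_notMem huv]
        simp [Expr.val, h₅]
      · intro x
        -- The second degree update reads its cell after the first one, so the two cells must
        -- differ.
        have hne : v.1 ≠ u.1 := fun h => hlt.ne (Fin.ext h.symm)
        rw [pairDegree_insert huv]
        by_cases hxv : x = v
        · subst hxv
          simp [Expr.val, hti, htj, h₆, hne]
        · have hxv' : x.1 ≠ v.1 := fun h => hxv (Fin.ext h)
          by_cases hxu : x = u
          · subst hxu
            simp [Expr.val, hti, htj, h₆, hxv']
          · have hxu' : x.1 ≠ u.1 := fun h => hxu (Fin.ext h)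
            simp [Expr.val, hti, htj, h₆, hxv', hxu', Ne.symm hxv, Ne.symm hxu]
    · refine .skip ⟨E, ?_, h₂, h₃, ?_, h₅, h₆⟩
      · intro e he
        exact ⟨(h₁ e he).1, (before_succ _ _ _ _).2 (Or.inl (h₁ e he).2)⟩
      · intro x y hb hxy hlt
        rw [before_succ] at hb
        rcases hb with hb | ⟨rfl, rfl⟩
        · exact h₄ x y hb hxy hlt
        · by_contra! hcon
          exact hcond.2 ⟨hxy, hlt, hcon.2.2.2, hcon.2.1, hcon.2.2.1⟩ h
  · rintro t ⟨E, h₁, h₂, h₃, h₄, -, h₆⟩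
    refine ⟨E, ⟨fun e he => (h₁ e he).1, h₂, h₃, fun x y hxy => ?_⟩, h₆⟩
    rcases lt_or_gt_of_ne hxy.ne with h | h
    · have := h₄ x y (before_top x y) hxy h
      tauto
    · have := h₄ y x (before_top y x) hxy.symm h
      tauto

lemma degreeProg_ends {I : Instance} {N : ℕ} (hn : I.n ≤ N) {s : Memory} (hs : Ready I s)
    (h₄ : s.arr 4 = 0) :
    Ends N degreeProg s fun s' => ∀ x : Fin I.n, s'.arr 4 x = 0 ↔ ∀ y, ¬ I.G.Adj x y := by
  refine Ends.imp (Ends.forTwo (r := I.n) (fun i j t =>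
    ∀ x : Fin I.n, t.arr 4 x = 0 ↔ ∀ y, Before i j x y → ¬ I.G.Adj x y)
    (fun _ _ _ _ h => h) (fun _ _ _ _ h => h) hs.n hn rfl rfl rfl ?_ ?_ ?_) ?_
  · intro x
    simp [h₄, not_before_zero]
  · intro i t h
    simpa only [before_row] using h
  · rintro i j t hi hj hti htj hf h
    obtain ⟨u, rfl⟩ : ∃ u : Fin I.n, u.1 = i := ⟨⟨i, hi⟩, rfl⟩
    obtain ⟨v, rfl⟩ : ∃ v : Fin I.n, v.1 = j := ⟨⟨j, hj⟩, rfl⟩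
    have hR : Ready I t := hf.ready hs rfl
    refine .store fun x => ?_
    simp only [before_succ]
    by_cases hx : x = u
    · subst hx
      have h' := adjBit_ne_zero (G := I.G) (x := x) (y := v)
      simp only [Expr.val, hR.val_adj hti htj, hti, Function.update_self, Nat.add_eq_zero_iff, h]
      constructor
      · rintro ⟨h₁, h₂⟩ y (hy | ⟨-, rfl⟩)
        · exact h₁ y hy
        · exact fun h => h'.2 h h₂
      · exact fun h₁ => ⟨fun y hy => h₁ y (Or.inl hy),
          by_contra fun h₂ => h₁ v (Or.inr ⟨trivial, rfl⟩) (h'.1 h₂)⟩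
    · have hx' : x.1 ≠ u.1 := fun h => hx (Fin.ext h)
      simpa [Expr.val, hti, hx', hx] using h x
  · intro t h x
    simpa [before_top] using h x

/-- The value `a` is a common neighbour of `x` and `y`, or stands for the absence of one. -/
structure IsChosen {n : ℕ} (G : SimpleGraph (Fin n)) (p : ℕ) (E : Finset (Fin n × Fin n))
    (x y : Fin n) (a : ℕ) : Prop where
  common : ∀ v, degreeBound p ≤ pairDegree E x → degreeBound p ≤ pairDegree E y →
    G.Adj x v → G.Adj y v → ∃ z : Fin n, a = z.1 ∧ G.Adj x z ∧ G.Adj y z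
  degree : a < n → degreeBound p ≤ pairDegree E x ∧ degreeBound p ≤ pairDegree E y

lemma neighbourProg_ends {I : Instance} {N : ℕ} (hn : I.n ≤ N) {s : Memory} (hs : Ready I s)
    (h₅ : s.arr 5 = 0) {E : Finset (Fin I.n × Fin I.n)}
    (hE : ∀ x : Fin I.n, s.arr 3 x = pairDegree E x) :
    Ends N neighbourProg s fun s' => ∃ w, IsNeighbourChoice I.G I.dualParam E w ∧
      ∀ z : Fin I.n, s'.arr 5 z ≠ 0 ↔ ∃ x y, w x y = z.1 := by
  set D := degreeBound I.dualParam with hD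
  refine Ends.imp (Ends.forTwo (r := I.n) (fun i j t => ∃ w : Fin I.n → Fin I.n → ℕ,
    (∀ x y, Before i j x y → IsChosen I.G I.dualParam E x y (w x y)) ∧
      ∀ z : Fin I.n, t.arr 5 z ≠ 0 ↔ ∃ x y, Before i j x y ∧ w x y = z.1)
    (fun _ _ _ _ h => h) (fun _ _ _ _ h => h) hs.n hn rfl rfl rfl ?_ ?_ ?_) ?_
  · exact ⟨fun _ _ => 0, fun x y h => absurd h (not_before_zero x y), by simp [h₅, not_before_zero]⟩
  · intro i t h
    simpa only [before_row] using h
  · rintro i j t hi hj hti htj hf ⟨w, h₁, h₂⟩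
    obtain ⟨u, rfl⟩ : ∃ u : Fin I.n, u.1 = i := ⟨⟨i, hi⟩, rfl⟩
    obtain ⟨v, rfl⟩ : ∃ v : Fin I.n, v.1 = j := ⟨⟨j, hj⟩, rfl⟩
    have hR : Ready I t := hf.ready hs rfl
    have hE' : ∀ x : Fin I.n, t.arr 3 x = pairDegree E x := by rwa [hf.arr 3 rfl]
    refine .seq (.assign (.seq (Ends.imp (Ends.frame (Ends.for (r := I.n) (fun i t =>
      (∀ v', v'.1 < i → D ≤ pairDegree E u → D ≤ pairDegree E v → I.G.Adj u v' → I.G.Adj v v' →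
        ∃ z : Fin I.n, t.reg 7 = z.1 ∧ I.G.Adj u z ∧ I.G.Adj v z) ∧
      (t.reg 7 < I.n → D ≤ pairDegree E u ∧ D ≤ pairDegree E v)) (fun _ _ _ h => h) hR.n hn rfl rfl
      ?_ ?_)) ?_)))
    · simp [Expr.val, hR.n]
    · rintro i t' hi ht' hf' ⟨h₃, h₄⟩
      obtain ⟨z, rfl⟩ : ∃ z : Fin I.n, z.1 = i := ⟨⟨i, hi⟩, rfl⟩
      have hR' : Ready I t' := hf'.ready ⟨hR.n, hR.p, hR.bound, hR.bound_sq, hR.adj⟩ rfl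
      have hu' : t'.reg 4 = u := (hf'.reg 4 rfl).trans hti
      have hv' : t'.reg 5 = v := (hf'.reg 5 rfl).trans htj
      have hE'' : ∀ x : Fin I.n, t'.arr 3 x = pairDegree E x := by rwa [hf'.arr 3 rfl]
      have hcond : (Expr.and (.and (.adj 4 8) (.adj 5 8))
        (.and (.sub (.add (.load 3 (.reg 4)) (.const 1)) (.reg 2))
          (.sub (.add (.load 3 (.reg 5)) (.const 1)) (.reg 2)))).val t' ≠ 0 ↔
          (I.G.Adj u z ∧ I.G.Adj v z) ∧ D ≤ pairDegree E u ∧ D ≤ pairDegree E v := by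
        simp only [Expr.and_val_ne_zero, hR'.val_adj hu' ht', hR'.val_adj hv' ht', adjBit_ne_zero]
        simp only [Expr.val, hu', hv', hR'.bound, hE'', Nat.sub_ne_zero_iff_lt, Nat.lt_succ_iff]
        rfl
      refine .cond (fun h => .assign ?_) (fun h => .skip ?_)
      · obtain ⟨h₅, h₆⟩ := hcond.1 h
        refine ⟨fun _ _ _ _ _ _ => ⟨z, ?_, h₅⟩, fun _ => h₆⟩
        simp [Expr.val, ht']
      · refine ⟨fun v' hv' hDu hDv hu hv => ?_, h₄⟩
        rcases Nat.lt_succ_iff_lt_or_eq.1 hv' with hlt | heq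
        · exact h₃ v' hlt hDu hDv hu hv
        · obtain rfl : v' = z := Fin.ext heq
          exact absurd h (hcond.2 ⟨⟨hu, hv⟩, hDu, hDv⟩)
    · rintro t' ⟨hf', h₃, h₄⟩
      have h₂' : ∀ z : Fin I.n, t'.arr 5 z ≠ 0 ↔ ∃ x y, Before u.1 v.1 x y ∧ w x y = z.1 := by
        rwa [hf'.arr 5 rfl]
      have hold : ∀ x y, Before u.1 v.1 x y → ¬ (x = u ∧ y = v) := by
        rintro x y h ⟨rfl, rfl⟩
        exact not_before_self _ _ h
      -- If there is no choice, register `7` still holds `n`, and the mark falls on a cell that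
      -- represents no vertex.
      refine .store ⟨fun x y => if x = u ∧ y = v then t'.reg 7 else w x y, ?_, ?_⟩
      · intro x y h
        rw [before_succ] at h
        rcases h with h | ⟨rfl, rfl⟩
        · dsimp only
          rw [if_neg (hold x y h)]
          exact h₁ x y h
        · dsimp only
          rw [if_pos ⟨rfl, rfl⟩]
          exact ⟨fun v => h₃ v v.2, h₄⟩
      · intro z
        simp only [before_succ, Expr.val, Function.update_self]
        by_cases hz : z.1 = t'.reg 7
        · rw [hz]
          simp only [Function.update_self, ne_eq, one_ne_zero, not_false_eq_true, true_iff]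
          exact ⟨u, v, Or.inr ⟨rfl, rfl⟩, if_pos ⟨rfl, rfl⟩⟩
        · rw [Function.update_of_ne hz, h₂']
          constructor
          · rintro ⟨x, y, h, hxy⟩
            exact ⟨x, y, Or.inl h, by rw [if_neg (hold x y h), hxy]⟩
          · rintro ⟨x, y, h | ⟨rfl, rfl⟩, hxy⟩
            · rw [if_neg (hold x y h)] at hxy
              exact ⟨x, y, h, hxy⟩
            · rw [if_pos ⟨rfl, rfl⟩] at hxy
              exact absurd hxy.symm hz
  · rintro t ⟨w, h₁, h₂⟩
    refine ⟨w, ⟨fun x y v => (h₁ x y (before_top x y)).common v,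
      fun x y => (h₁ x y (before_top x y)).degree⟩, fun z => ?_⟩
    simpa [before_top] using h₂ z

lemma isolatedBefore_succ {n : ℕ} (G : SimpleGraph (Fin n)) (v : Fin n) {a : ℕ}
    (ha : a = 0 ↔ ∀ y, ¬ G.Adj v y) :
    isolatedBefore G (v.1 + 1) = isolatedBefore G v.1 + (1 - a) := by
  classical
  unfold isolatedBefore
  have hlt : ∀ u : Fin n, u.1 < v.1 + 1 ↔ u.1 < v.1 ∨ u = v := fun u => by
    rw [Nat.lt_succ_iff_lt_or_eq, Fin.ext_iff]
  by_cases h : ∀ y, ¬ G.Adj v y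
  · have : (Finset.univ.filter fun u : Fin n => u.1 < v.1 + 1 ∧ ∀ y, ¬ G.Adj u y) =
        insert v (Finset.univ.filter fun u : Fin n => u.1 < v.1 ∧ ∀ y, ¬ G.Adj u y) := by
      ext u
      simp only [Finset.mem_filter, Finset.mem_univ, true_and, Finset.mem_insert, hlt]
      constructor
      · tauto
      · rintro (rfl | h')
        · exact ⟨Or.inr rfl, h⟩
        · exact ⟨Or.inl h'.1, h'.2⟩
    rw [this, Finset.card_insert_of_notMem (by simp), ha.2 h]
  · have h₁ : 1 - a = 0 := by
      have : a ≠ 0 := fun h' => h (ha.1 h')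
      omega
    rw [h₁, add_zero]
    congr 1
    ext u
    simp only [Finset.mem_filter, Finset.mem_univ, true_and, hlt]
    constructor
    · rintro ⟨h' | rfl, h''⟩
      · exact ⟨h', h''⟩
      · exact absurd h'' h
    · exact fun h' => ⟨Or.inl h'.1, h'.2⟩

lemma collectProg_ends {I : Instance} {N : ℕ} (hn : I.n ≤ N) {s : Memory} (hs : Ready I s)
    {E : Finset (Fin I.n × Fin I.n)} {w : Fin I.n → Fin I.n → ℕ}
    (h₃ : ∀ x : Fin I.n, s.arr 3 x = pairDegree E x)
    (h₄ : ∀ x : Fin I.n, s.arr 4 x = 0 ↔ ∀ y, ¬ I.G.Adj x y)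
    (h₅ : ∀ z : Fin I.n, s.arr 5 z ≠ 0 ↔ ∃ x y, w x y = z.1) :
    Ends N collectProg s fun s' => ∃ l : List (Fin I.n), l.Nodup ∧
      (∀ v, v ∈ l ↔ IsKept I.G I.dualParam E w v) ∧ s'.reg 10 = l.length ∧
      ∀ i (h : i < l.length), s'.arr 6 i = l[i] := by
  refine .seq (.assign (.seq (.assign (Ends.imp (Ends.for (r := I.n) (fun i t =>
    t.reg 9 = isolatedBefore I.G i ∧ ∃ l : List (Fin I.n), l.Nodup ∧
      (∀ v, v ∈ l ↔ v.1 < i ∧ IsKept I.G I.dualParam E w v) ∧ t.reg 10 = l.length ∧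
      ∀ i (h : i < l.length), t.arr 6 i = l[i]) (fun _ _ _ h => h) hs.n hn rfl rfl ?_ ?_) ?_))))
  · exact ⟨by simp [Expr.val, isolatedBefore], [], by simp [Expr.val]⟩
  · rintro i t hi ht hf ⟨h₉, l, hl, hm, hlen, hl₆⟩
    obtain ⟨v, rfl⟩ : ∃ v : Fin I.n, v.1 = i := ⟨⟨i, hi⟩, rfl⟩
    have hR : Ready I t := hf.ready ⟨hs.n, hs.p, hs.bound, hs.bound_sq, hs.adj⟩ rfl
    have h₃' : t.arr 3 v = pairDegree E v := by rw [hf.arr 3 rfl]; exact h₃ v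
    have h₄' : t.arr 4 v = 0 ↔ ∀ y, ¬ I.G.Adj v y := by rw [hf.arr 4 rfl]; exact h₄ v
    have h₅' : t.arr 5 v ≠ 0 ↔ ∃ x y, w x y = v.1 := by rw [hf.arr 5 rfl]; exact h₅ v
    have hiso := isolatedBefore_succ I.G v h₄'
    have hcond : (Expr.add (.sub (.reg 1) (.reg 4)) (.add (.load 3 (.reg 4))
        (.add (.load 5 (.reg 4)) (.and (.sub (.const 1) (.load 4 (.reg 4)))
        (.sub (.reg 1) (.reg 9)))))).val t ≠ 0 ↔ IsKept I.G I.dualParam E w v := by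
      -- A sum of natural numbers is nonzero iff a summand is, so addition acts as disjunction.
      have hadd : ∀ e₁ e₂ : Expr, (e₁.add e₂).val t ≠ 0 ↔ e₁.val t ≠ 0 ∨ e₂.val t ≠ 0 := by
        intro e₁ e₂
        rw [Expr.val]
        omega
      have hsub : 1 - t.arr 4 v ≠ 0 ↔ t.arr 4 v = 0 := by omega
      rw [hadd, hadd, hadd, Expr.and_val_ne_zero]
      simp only [Expr.val, ht, hR.p, h₃', h₅', h₉, Nat.sub_ne_zero_iff_lt, IsKept,
        Nat.pos_iff_ne_zero, hsub, h₄']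
    refine .seq (.cond (fun h => ?_) (fun h => ?_))
    · refine .seq (.store (.assign (.assign ⟨?_, l ++ [v], ?_, ?_, ?_, ?_⟩)))
      · simp [Expr.val, ht, h₉, hiso]
      · rw [List.nodup_append]
        refine ⟨hl, by simp, ?_⟩
        rintro a ha b hb rfl
        obtain rfl : a = v := by simpa using hb
        exact lt_irrefl _ ((hm a).1 ha).1
      · intro x
        rw [List.mem_append, hm, List.mem_singleton, Nat.lt_succ_iff_lt_or_eq, ← Fin.ext_iff]
        constructor
        · rintro (h' | rfl)
          · exact ⟨Or.inl h'.1, h'.2⟩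
          · exact ⟨Or.inr rfl, hcond.1 h⟩
        · rintro ⟨h₁ | h₁, h₂⟩
          · exact Or.inl ⟨h₁, h₂⟩
          · exact Or.inr h₁
      · simp [Expr.val, hlen]
      · intro i hi
        rw [List.length_append, List.length_singleton, Nat.lt_succ_iff_lt_or_eq] at hi
        rcases hi with hi | rfl
        · simpa [Expr.val, hlen, hi.ne, List.getElem_append_left hi] using hl₆ i hi
        · simp [Expr.val, hlen, ht]
    · refine .skip (.assign ⟨?_, l, hl, ?_, hlen, hl₆⟩)
      · simp [Expr.val, ht, h₉, hiso]
      · intro x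
        rw [hm, Nat.lt_succ_iff_lt_or_eq, ← Fin.ext_iff]
        constructor
        · exact fun h' => ⟨Or.inl h'.1, h'.2⟩
        · rintro ⟨h₁ | rfl, h₂⟩
          · exact ⟨h₁, h₂⟩
          · exact absurd h (hcond.2 h₂)
  · rintro t ⟨-, l, hl, hm, hlen, hl₆⟩
    exact ⟨l, hl, fun v => by simp [hm], hlen, hl₆⟩

lemma outputProg_ends {I J : Instance} {N : ℕ} (hn : J.n ≤ N) {s : Memory} (hs : Ready I s)
    {φ : Fin J.n → Fin I.n} (hJ : s.reg 10 = J.n) (hk : J.k = J.n - I.dualParam)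
    (hG : J.G = I.G.comap φ) (hφ : ∀ i : Fin J.n, s.arr 6 i = φ i) :
    Ends N outputProg s fun s' => HasOutput s' J.encode := by
  refine .seq (.store (.seq (.store (.seq (.assign (Ends.imp (Ends.forTwo (r := J.n) (fun i j t =>
    t.reg 11 = 2 + i * J.n + j ∧ t.arr 1 0 = J.n ∧ t.arr 1 1 = J.k ∧
      ∀ x y : Fin J.n, Before i j x y → t.arr 1 (2 + x * J.n + y) = adjBit J.G x y)
    (fun _ _ _ _ h => h) (fun _ _ _ _ h => h) hJ hn rfl rfl rfl ?_ ?_ ?_) ?_))))))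
  · refine ⟨by simp [Expr.val], by simp [Expr.val, hJ], ?_,
      fun x y h => absurd h (not_before_zero x y)⟩
    simp [Expr.val, hJ, hs.p, hk]
  · rintro i t ⟨h₁, h₂, h₃, h₄⟩
    simp only [before_row] at h₄
    exact ⟨by rw [h₁]; ring, h₂, h₃, h₄⟩
  · rintro i j t hi hj hti htj hf ⟨h₁, h₂, h₃, h₄⟩
    obtain ⟨u, rfl⟩ : ∃ u : Fin J.n, u.1 = i := ⟨⟨i, hi⟩, rfl⟩
    obtain ⟨v, rfl⟩ : ∃ v : Fin J.n, v.1 = j := ⟨⟨j, hj⟩, rfl⟩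
    have hR : Ready I t := hf.ready ⟨hs.n, hs.p, hs.bound, hs.bound_sq, hs.adj⟩ rfl
    have h₆ : ∀ i : Fin J.n, t.arr 6 i = φ i := by
      rw [hf.arr 6 rfl]
      exact hφ
    have hval : t.arr 0 (t.arr 2 (φ u) + φ v) = adjBit J.G u v := by
      rw [hR.adj, hG]
      rfl
    refine .seq (.store (.assign ⟨?_, ?_, ?_, ?_⟩))
    · simp [Expr.val, h₁, add_assoc]
    · have : 0 ≠ 2 + u.1 * J.n + v.1 := by omega
      simpa [Expr.val, h₁, this] using h₂
    · have : 1 ≠ 2 + u.1 * J.n + v.1 := by omega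
      simpa [Expr.val, h₁, this] using h₃
    · intro x y hb
      rw [before_succ] at hb
      rcases hb with hb | ⟨rfl, rfl⟩
      -- In row-major order an earlier entry occupies a smaller cell, so it is not overwritten.
      · have hne : 2 + x.1 * J.n + y.1 ≠ 2 + u.1 * J.n + v.1 := by
          have hy := y.2
          rcases hb with hb | ⟨hb, hb'⟩
          · have : (x.1 + 1) * J.n ≤ u.1 * J.n := Nat.mul_le_mul_right _ hb
            rw [add_mul] at this
            omega
          · rw [hb]
            omega
        simpa [Expr.val, h₁, hne] using h₄ x y hb
      · simp [Expr.val, h₁, hti, htj, h₆, hval]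
  · rintro t ⟨-, h₂, h₃, h₄⟩
    exact hasOutput_encode h₂ h₃ fun x y => h₄ x y (before_top x y)

/-! ### Assembly of the phases into a polynomial-time kernelization. -/

/-- The kernelization. -/
def kernelProg : Prog :=
  .seq setupProg <| .seq greedyProg <| .seq degreeProg <| .seq neighbourProg <|
    .seq collectProg outputProg

lemma kernelProg_ends (I : Instance) {N : ℕ} (hn : I.n ≤ N) (hD : degreeBound I.dualParam ≤ N) :
    Ends N kernelProg (initMemory I.encode) fun s =>
      ∃ J, IsKernelization I J ∧ HasOutput s J.encode := by
  refine .seq ((setupProg_ends I hn hD).imp fun s₁ ⟨hR₁, h₃, h₄, h₅⟩ => ?_)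
  refine .seq ((greedyProg_ends hn hR₁ h₃).frame.imp fun s₂ ⟨hf₂, E, hE, hE₂⟩ => ?_)
  have hR₂ := hf₂.ready hR₁ rfl
  refine .seq ((degreeProg_ends hn hR₂ ((hf₂.arr 4 rfl).trans h₄)).frame.imp fun s₃ ⟨hf₃, h₄⟩ => ?_)
  have hR₃ := hf₃.ready hR₂ rfl
  have hE₃ : ∀ x : Fin I.n, s₃.arr 3 x = pairDegree E x := by rwa [hf₃.arr 3 rfl]
  refine .seq ((neighbourProg_ends hn hR₃ ((hf₃.arr 5 rfl).trans ((hf₂.arr 5 rfl).trans h₅))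
    hE₃).frame.imp fun s₄ ⟨hf₄, w, hw, h₅⟩ => ?_)
  have hR₄ := hf₄.ready hR₃ rfl
  refine .seq ((collectProg_ends hn hR₄ (E := E) (w := w) (by rwa [hf₄.arr 3 rfl])
    (by rwa [hf₄.arr 4 rfl]) h₅).frame.imp fun s₅ ⟨hf₅, l, hl, hm, hlen, h₆⟩ => ?_)
  have hR₅ := hf₅.ready hR₄ rfl
  have hln : l.length ≤ N := (by simpa using hl.length_le_card : l.length ≤ I.n).trans hn
  let J : Instance := ⟨l.length, I.G.comap l.get, l.length - I.dualParam⟩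
  refine (outputProg_ends (J := J) hln hR₅ hlen rfl rfl fun i => h₆ i i.2).imp fun s₆ h =>
    ⟨J, ⟨E, w, l.get, hE, hw, List.nodup_iff_injective_get.1 hl, fun v => ?_, rfl, rfl⟩, h⟩
  rw [← hm, List.mem_iff_get]
  rfl

lemma exists_kernelization : ∃ K : Instance → Instance, PolyTimeComputable K ∧
    ∀ I, IsKernelization I (K I) := by
  have h : ∀ I : Instance, ∃ J s t, IsKernelization I J ∧ Exec kernelProg (initMemory I.encode) s t ∧
      t ≤ (kernelProg.timeBound.comp (4 * Polynomial.X)).eval I.encode.length ∧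
      HasOutput s J.encode := by
    intro I
    have hp : I.dualParam ≤ I.n := Nat.sub_le _ _
    -- The input has `n² + 2` words, so four times its length dominates both `n` and `4p² + 1`, the
    -- bounds on loop rounds.
    obtain ⟨s, t, he, ht, J, hJ, ho⟩ := kernelProg_ends I (N := 4 * I.encode.length)
      (by rw [Instance.length_encode]; nlinarith)
      (by rw [Instance.length_encode, degreeBound]; nlinarith)
    exact ⟨J, s, t, hJ, he, by simpa [Polynomial.eval_comp] using ht, ho⟩
  choose K s t hK he ht ho using h
  exact ⟨K, ⟨kernelProg, _, fun I => ⟨s I, t I, he I, ht I, ho I⟩⟩, hK⟩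

end VertexIdentification

theorem mainTheorem8 :
    (∃ c : ℕ, VertexIdentification.AdmitsKernel VertexIdentification.CliqueIdentification
      (fun p => c * max 1 p ^ 4)) ∧
    (∃ c : ℕ, VertexIdentification.AdmitsKernel VertexIdentification.ClusterIdentification
      (fun p => c * max 1 p ^ 4)) := by
  obtain ⟨K, hK, h⟩ := VertexIdentification.exists_kernelization
  have hk : ∀ I, (K I).k ≤ (K I).n := by
    intro I
    obtain ⟨_, _, _, _, _, _, _, _, hk⟩ := h I
    exact hk ▸ Nat.sub_le _ _
  exact ⟨⟨152, K, hK, fun I => ⟨(h I).mem_iff.1, (h I).n_le, (hk I).trans (h I).n_le⟩⟩,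
    ⟨152, K, hK, fun I => ⟨(h I).mem_iff.2, (h I).n_le, (hk I).trans (h I).n_le⟩⟩⟩
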